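/- Let $E_{ij}$ be the elementary $9\times 9$ matrices and $R_{ij}=E_{ij}-E_{ji}$, so that $\mathfrak{so}(9)=\mathrm{span}_{\mathbb R}\{R_{ij}\}$. For $1\le j\le 4$ put $\mathrm iH_j=-R_{2j-1,2j}$; these span the Lie algebra of a maximal torus $T$ of $\mathrm{SO}(9)$. To the positive roots of $B_4$ (with $f^1,\dots,f^4$ the coordinates dual to $H_1,\dots,H_4$) attach the pairs $(X_\alpha,Y_\alpha)$: - $\alpha=f^j$: $X=R_{2j-1,9}$, $Y=R_{2j,9}$; - $\alpha=f^j+f^k$, $j<k$: $X=\tfrac{\sqrt2}{2}(-R_{2j-1,2k-1}+R_{2j,2k})$, $Y=\tfrac{\sqrt2}{2}(-R_{2j-1,2k}-R_{2j,2k-1})$; - $\alpha=f^j-f^k$, $j<k$: $X=\tfrac{\sqrt2}{2}(-R_{2j-1,2k-1}-R_{2j,2k})$, $Y=\tfrac{\sqrt2}{2}(R_{2j-1,2k}-R_{2j,2k-1})$. Number them $(X_1,Y_1),\dots,(X_{16},Y_{16})$ in the order $f^1,f^2,f^3,f^4$; $f^1+f^2,f^1+f^3,f^1+f^4,f^2+f^3,f^2+f^4,f^3+f^4$;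 $f^1-f^2,f^1-f^3,f^1-f^4,f^2-f^3,f^2-f^4,f^3-f^4$. Let $I$ be the left-invariant almost complex structure on $\mathrm{SO}(9)$ with $I(\mathrm iH_1)=\mathrm iH_2$, $I(\mathrm iH_3)=\mathrm iH_4$, $IX_j=Y_j$, and let $\varphi_1,\dots,\varphi_{18}$ be the left-invariant $(1,0)$-coframe dual to the frame: writing $(u_1,v_1)=(\mathrm iH_1,\mathrm iH_2)$, $(u_2,v_2)=(\mathrm iH_3,\mathrm iH_4)$, $(u_{k+2},v_{k+2})=(X_k,Y_k)$, one has $\varphi_k(u_l)=\delta_{kl}$, $\varphi_k(v_l)=\mathrm i\,\delta_{kl}$. Let $g_0=-\tfrac1{14}B$, where $B$ is the Killing form of $\mathfrak{so}(9)$. A left-invariant $I$-Hermitian metric $g$, with fundamental form $F(u,v)=g(Iu,v)$, is SKT if $\partial\overline\partial F=0$. (0) $I$ is integrable and is the Samelson complex structure of these positive roots: with $\alpha_k$ the $k$-th positive root, $[\mathrm iH_j,X_k]=\alpha_k(H_j)Y_k$ and $[\mathrm iH_j,Y_k]=-\alpha_k(H_j)X_k$. (1) Let $b_1,\dots,b_{18}>0$,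 and let $g_b$ be the left-invariant metric for which the frame is orthogonal and $g_b(u_k,u_k)=g_b(v_k,v_k)=b_k$. Then $g_b$ is $I$-Hermitian and right $T$-invariant, its fundamental form is $F_b=\tfrac{\mathrm i}{2}\sum_{k=1}^{18}b_k\,\varphi_k\wedge\overline\varphi_k$, and $g_b$ is SKT if and only if $$\begin{aligned} b_1&=b_2=b_{16}-b_{17}+b_{18}, & b_3&=b_6+b_{15}-b_{16}+b_{17}-b_{18},\\ b_4&=b_6-b_{16}+2b_{17}-b_{18}, & b_5&=b_6-b_{16}+b_{17},\\ b_7&=2b_6+b_{15}-3b_{16}+4b_{17}-3b_{18}, & b_8&=2b_6+b_{15}-3b_{16}+3b_{17}-2b_{18},\\ b_9&=2b_6+b_{15}-2b_{16}+2b_{17}-2b_{18}, & b_{10}&=2b_6-3b_{16}+4b_{17}-2b_{18},\\ b_{11}&=2b_6-2b_{16}+3b_{17}-2b_{18}, & b_{12}&=2b_6-2b_{16}+2b_{17}-b_{18},\\ b_{13}&=b_{15}+b_{16}-2b_{17}+b_{18}, & b_{14}&=b_{15}+b_{16}-b_{17}. \end{aligned}$$ (2) The parameters $(b_6,b_{15},b_{16},b_{17},b_{18})\in\mathbb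 R^5$ for which all eighteen coefficients are positive form a nonempty open set, and distinct parameters give distinct metrics. So one obtains a $5$-parameter family of left-invariant, right $T$-invariant $I$-Hermitian SKT metrics. This family consists of all left-invariant $I$-Hermitian SKT metrics on $\mathrm{SO}(9)$ that are also right $T$-invariant. (3) The metric $g_0$ is $I$-Hermitian and SKT; let $F_0$ be its fundamental form. For $F$ in the family, $F=F_0$ if and only if $b_6=b_{15}=b_{16}=b_{17}=b_{18}=1$. Moreover $$\begin{aligned}F={}&(b_{16}-b_{17}+b_{18})F_0-\tfrac12(b_6+b_{15}-2b_{16}+2b_{17}-2b_{18})\,d(\varphi_1+\overline\varphi_1)-\tfrac{\mathrm i}2(b_6-2b_{16}+3b_{17}-2b_{18})\,d(\overline\varphi_1-\varphi_1)\\&-\tfrac12(b_6-2b_{16}+2b_{17}-b_{18})\,d(\varphi_2+\overline\varphi_2)-\tfrac{\mathrm i}2(b_6-b_{16}+b_{17}-b_{18})\,d(\overline\varphi_2-\varphi_2),\end{aligned}$$ with the convention $d\theta(u,v)=-\theta([u,v])$ for left-invariant $1$-forms, and in the Aeppli cohomology $H^{1,1}_A=\{\partial\overline\partial\text{-closed smooth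 }(1,1)\text{-forms}\}/(\partial\Omega^{0,1}+\overline\partial\Omega^{1,0})$ of $(\mathrm{SO}(9),I)$ $$[F]_A=(b_{16}-b_{17}+b_{18})\,[F_0]_A,\qquad b_{16}-b_{17}+b_{18}>0.$$ That is, up to a positive factor each metric of the family has the same Aeppli class as the Killing-form metric, and exactly the same class when it is normalised by $b_{16}-b_{17}+b_{18}=1$. -/

import Mathlib

open scoped Matrix

attribute [local instance 100] LieRing.ofAssociativeRing LieAlgebra.ofAssociativeAlgebra

attribute [local instance] Matrix.normedAddCommGroup Matrix.normedSpace

noncomputable section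

namespace SO9

/-! ### The group, its Lie algebra, and the exponential -/

/-- The compact Lie group `SO(9)`. -/
abbrev G : Type := Matrix.specialOrthogonalGroup (Fin 9) ℝ

/-- The Lie algebra of `SO(9)`: skew-symmetric real matrices with the matrix commutator. -/
def 𝔤 : Type := LieAlgebra.Orthogonal.so (Fin 9) ℝ

instance : LieRing 𝔤 := inferInstanceAs (LieRing (LieAlgebra.Orthogonal.so (Fin 9) ℝ))

instance : LieAlgebra ℝ 𝔤 := inferInstanceAs (LieAlgebra ℝ (LieAlgebra.Orthogonal.so (Fin 9) ℝ))

/-- The inclusion of `so(9)` into the `9 × 9` matrices. -/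
def toMat : 𝔤 →ₗ[ℝ] Matrix (Fin 9) (Fin 9) ℝ :=
  (LieAlgebra.Orthogonal.so (Fin 9) ℝ).toSubmodule.subtype

theorem toMat_injective : Function.Injective toMat := Subtype.val_injective

theorem toMat_lie (u v : 𝔤) : toMat ⁅u, v⁆ = toMat u * toMat v - toMat v * toMat u := rfl

instance : NormedAddCommGroup 𝔤 :=
  NormedAddCommGroup.induced 𝔤 (Matrix (Fin 9) (Fin 9) ℝ) toMat toMat_injective

instance : NormedSpace ℝ 𝔤 := NormedSpace.induced ℝ 𝔤 (Matrix (Fin 9) (Fin 9) ℝ) toMat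

instance : FiniteDimensional ℝ 𝔤 :=
  inferInstanceAs (FiniteDimensional ℝ (LieAlgebra.Orthogonal.so (Fin 9) ℝ).toSubmodule)

theorem transpose_coe (u : 𝔤) : (toMat u)ᵀ = -toMat u :=
  (LieAlgebra.Orthogonal.mem_so (Fin 9) ℝ _).1 u.2

theorem exp_mem (u : 𝔤) :
    NormedSpace.exp (toMat u) ∈ Matrix.specialOrthogonalGroup (Fin 9) ℝ := by
  have key : ∀ A : Matrix (Fin 9) (Fin 9) ℝ, Aᵀ = -A →
      NormedSpace.exp A * (NormedSpace.exp A)ᵀ = 1 := by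
    intro A hA
    rw [← Matrix.exp_transpose, hA,
      ← Matrix.exp_add_of_commute _ _ (Commute.neg_right (Commute.refl A))]
    simp
  have hu := transpose_coe u
  rw [Matrix.mem_specialOrthogonalGroup_iff, Matrix.mem_orthogonalGroup_iff]
  refine ⟨key _ hu, ?_⟩
  have hh := key ((1 / 2 : ℝ) • toMat u) (by
    rw [Matrix.transpose_smul, hu, smul_neg])
  have h2 : toMat u =
      (1 / 2 : ℝ) • toMat u + (1 / 2 : ℝ) • toMat u := by
    rw [← add_smul]; norm_num
  rw [h2, Matrix.exp_add_of_commute _ _ rfl, Matrix.det_mul]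
  have := congrArg Matrix.det hh
  rwa [Matrix.det_mul, Matrix.det_transpose, Matrix.det_one] at this

/-- The exponential map `so(9) → SO(9)`. -/
def exp (u : 𝔤) : G := ⟨NormedSpace.exp (toMat u), exp_mem u⟩

theorem Ad_mem (h : G) (u : 𝔤) :
    (h : Matrix (Fin 9) (Fin 9) ℝ) * toMat u * (h : Matrix (Fin 9) (Fin 9) ℝ)ᵀ ∈
      LieAlgebra.Orthogonal.so (Fin 9) ℝ := by
  rw [LieAlgebra.Orthogonal.mem_so]
  simp [Matrix.transpose_mul, transpose_coe, Matrix.mul_assoc]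

/-- The adjoint action `Ad(h) u = h u h⁻¹`, where `h⁻¹ = hᵀ`. -/
def Ad (h : G) (u : 𝔤) : 𝔤 :=
  ⟨(h : Matrix (Fin 9) (Fin 9) ℝ) * toMat u * (h : Matrix (Fin 9) (Fin 9) ℝ)ᵀ, Ad_mem h u⟩

/-! ### The adapted frame, the complex structure and the `(1,0)`-coframe

Matrix indices run from `0` to `8`, frame indices from `0` to `17`. -/

/-- `R i j = E_{ij} - E_{ji}`. -/
def R (i j : Fin 9) : 𝔤 :=
  ⟨Matrix.single i j 1 - Matrix.single j i 1, by
    rw [LieAlgebra.Orthogonal.mem_so]; simp⟩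

/-- First matrix index `2j` of the `j`-th torus block. -/
def fstIx : Fin 4 → Fin 9 := ![0, 2, 4, 6]

/-- Second matrix index `2j + 1` of the `j`-th torus block. -/
def sndIx : Fin 4 → Fin 9 := ![1, 3, 5, 7]

/-- `tor j` is the real torus generator `i H_{j+1}`. -/
def tor (j : Fin 4) : 𝔤 := -R (fstIx j) (sndIx j)

/-- The pair `(X_α, Y_α)` for the short root `α = f^j`. -/
def shortRoot (j : Fin 4) : 𝔤 × 𝔤 := (R (fstIx j) 8, R (sndIx j) 8)

/-- The pair `(X_α, Y_α)` for `α = f^j + f^k`. -/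
def sumRoot (j k : Fin 4) : 𝔤 × 𝔤 :=
  ((√2 / 2) • (-R (fstIx j) (fstIx k) + R (sndIx j) (sndIx k)),
   (√2 / 2) • (-R (fstIx j) (sndIx k) - R (sndIx j) (fstIx k)))

/-- The pair `(X_α, Y_α)` for `α = f^j - f^k`. -/
def diffRoot (j k : Fin 4) : 𝔤 × 𝔤 :=
  ((√2 / 2) • (-R (fstIx j) (fstIx k) - R (sndIx j) (sndIx k)),
   (√2 / 2) • (R (fstIx j) (sndIx k) - R (sndIx j) (fstIx k)))

/-- The frame of `so(9)`, in pairs: `(iH₁, iH₂)`, `(iH₃, iH₄)`, `(X₁, Y₁)`, …, `(X₁₆, Y₁₆)`. -/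
def frame : Fin 18 → 𝔤 × 𝔤 :=
  ![(tor 0, tor 1), (tor 2, tor 3),
    shortRoot 0, shortRoot 1, shortRoot 2, shortRoot 3,
    sumRoot 0 1, sumRoot 0 2, sumRoot 0 3, sumRoot 1 2, sumRoot 1 3, sumRoot 2 3,
    diffRoot 0 1, diffRoot 0 2, diffRoot 0 3, diffRoot 1 2, diffRoot 1 3, diffRoot 2 3]

/-- The positive root attached to the `k`-th pair `(X, Y)`, in the coordinates `f¹, …, f⁴`. -/
def posRoot : Fin 16 → Fin 4 → ℝ :=
  ![![1, 0, 0, 0], ![0, 1, 0, 0], ![0, 0, 1, 0], ![0, 0, 0, 1],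
    ![1, 1, 0, 0], ![1, 0, 1, 0], ![1, 0, 0, 1], ![0, 1, 1, 0], ![0, 1, 0, 1], ![0, 0, 1, 1],
    ![1, -1, 0, 0], ![1, 0, -1, 0], ![1, 0, 0, -1], ![0, 1, -1, 0], ![0, 1, 0, -1], ![0, 0, 1, -1]]

/-- The coordinate functional `v ↦ -½ tr(u v)`. The frame vectors are orthonormal for this
inner product, so for a frame vector `u` this is the corresponding dual basis vector. -/
def coord (u : 𝔤) : 𝔤 →L[ℝ] ℝ :=
  LinearMap.toContinuousLinearMap
    { toFun := fun v => -(1 / 2) * Matrix.trace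
        (toMat u * toMat v)
      map_add' := fun v w => by simp [mul_add]
      map_smul' := fun c v => by simp; ring }

/-- The complex structure `I` on `so(9)` (extended to `SO(9)` by left translations): it sends the
first vector of each frame pair to the second one and the second one to minus the first. -/
def I : 𝔤 →L[ℝ] 𝔤 :=
  ∑ k, ((coord (frame k).1).smulRight (frame k).2 - (coord (frame k).2).smulRight (frame k).1)

/-- The left-invariant `(1,0)`-forms `φ_{k+1}`: the complex coframe dual to the frame. -/
def φ (k : Fin 18) : 𝔤 →L[ℝ] ℂ :=
  Complex.ofRealCLM.comp (coord (frame k).1) +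
    Complex.I • Complex.ofRealCLM.comp (coord (frame k).2)

/-- The complex conjugate `φ̄_{k+1}`. -/
def φbar (k : Fin 18) : 𝔤 →L[ℝ] ℂ := Complex.conjCLE.toContinuousLinearMap.comp (φ k)

/-! ### Complex differential forms on `SO(9)`

The tangent bundle is trivialised by left translations, so a complex-valued `n`-form on `SO(9)` is
a function from `SO(9)` to alternating `n`-forms on `so(9)`; its value at `x` on the tangent
vectors `x u₁, …, x uₙ` is `ω x ![u₁, …, uₙ]`. Left-invariant forms are the constant functions. -/

/-- Alternating real-multilinear complex-valued `n`-forms on `so(9)`. -/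
abbrev Alt (n : ℕ) : Type := 𝔤 [⋀^Fin n]→L[ℝ] ℂ

/-- Complex-valued differential `n`-forms on `SO(9)`, in the left trivialisation. -/
abbrev Form (n : ℕ) : Type := G → Alt n

/-- The left-invariant form with value `ω` at the identity. -/
def leftInv {n : ℕ} (ω : Alt n) : Form n := fun _ => ω

/-- Smoothness of a form, tested in the parametrisations `v ↦ x exp(v)`. -/
def IsSmooth {n : ℕ} (ω : Form n) : Prop := ∀ x : G, ContDiff ℝ (⊤ : ℕ∞) fun v : 𝔤 => ω (x * exp v)

/-- The derivative of a form along left-invariant vector fields: `leftDeriv ω x u` is the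
derivative at `x` of the coefficients of `ω` along the left-invariant field generated by `u`. -/
def leftDeriv {n : ℕ} (ω : Form n) (x : G) : 𝔤 →L[ℝ] Alt n :=
  fderiv ℝ (fun v : 𝔤 => ω (x * exp v)) 0

/-- The Lie bracket as a continuous bilinear map. -/
def bracket : 𝔤 →L[ℝ] 𝔤 →L[ℝ] 𝔤 :=
  LinearMap.toContinuousBilinearMap (LieModule.toEnd ℝ 𝔤 𝔤 : 𝔤 →ₗ[ℝ] 𝔤 →ₗ[ℝ] 𝔤)

/-- The bracket part `∑_{i<j} (-1)^{i+j} ω([u_i, u_j], u_0, …, û_i, …, û_j, …)` of the exterior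
derivative. It is written as `-½` times the sum over all ordered pairs of distinct indices. -/
def bracketPart {n : ℕ} (ω : Alt (n + 1)) : Alt (n + 2) :=
  -(1 / 2 : ℝ) • ContinuousAlternatingMap.alternatizeUncurryFin
    ((ContinuousAlternatingMap.alternatizeUncurryFinCLM ℝ 𝔤 ℂ).comp
      ((ContinuousLinearMap.compL ℝ 𝔤 𝔤 (Alt n) ω.curryLeft).comp bracket))

/-- The exterior derivative of a form of positive degree, by the invariant formula in terms of
left-invariant vector fields:
`dω(u_0, …) = ∑ (-1)^i u_i · ω(…, û_i, …) + ∑_{i<j} (-1)^{i+j} ω([u_i, u_j], …, û_i, …, û_j, …)`. -/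
def d {n : ℕ} (ω : Form (n + 1)) : Form (n + 2) := fun x =>
  ContinuousAlternatingMap.alternatizeUncurryFin (leftDeriv ω x) + bracketPart (ω x)

theorem bracket_apply (u v : 𝔤) : bracket u v = ⁅u, v⁆ := rfl

theorem removeNth_one_two (a b : 𝔤) : Fin.removeNth 1 ![a, b] = ![a] := by
  ext i : 1; fin_cases i; rfl

theorem removeNth_one_three (a b c : 𝔤) : Fin.removeNth 1 ![a, b, c] = ![a, c] := by
  ext i : 1; fin_cases i <;> rfl

theorem removeNth_two_three (a b c : 𝔤) : Fin.removeNth 2 ![a, b, c] = ![a, b] := by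
  ext i : 1; fin_cases i <;> rfl

theorem d_one_apply (ω : Form 1) (x : G) (u v : 𝔤) :
    d ω x ![u, v] = leftDeriv ω x u ![v] - leftDeriv ω x v ![u] - ω x ![⁅u, v⁆] := by
  have h : ω x ![⁅v, u⁆] = -ω x ![⁅u, v⁆] := by
    have hu : ∀ a b : 𝔤, Function.update ![a] 0 b = ![b] := by
      intro a b; ext i : 1; fin_cases i; rfl
    have := (ω x).map_update_smul ![⁅u, v⁆] 0 (-1 : ℝ) ⁅u, v⁆
    rw [hu, hu] at this
    simpa using this
  simp [d, bracketPart, ContinuousAlternatingMap.alternatizeUncurryFin_apply, Fin.sum_univ_two,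
    removeNth_one_two, bracket_apply, h]
  ring

theorem d_two_apply (ω : Form 2) (x : G) (u v w : 𝔤) :
    d ω x ![u, v, w] =
      leftDeriv ω x u ![v, w] - leftDeriv ω x v ![u, w] + leftDeriv ω x w ![u, v]
        - ω x ![⁅u, v⁆, w] + ω x ![⁅u, w⁆, v] - ω x ![⁅v, w⁆, u] := by
  have h : ∀ a b c : 𝔤, ω x ![⁅b, a⁆, c] = -ω x ![⁅a, b⁆, c] := by
    intro a b c
    have hu : ∀ p q : 𝔤, Function.update ![p, c] 0 q = ![q, c] := by
      intro p q; ext i : 1; fin_cases i <;> rfl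
    have := (ω x).map_update_smul ![⁅a, b⁆, c] 0 (-1 : ℝ) ⁅a, b⁆
    rw [hu, hu] at this
    simpa using this
  simp [d, bracketPart, ContinuousAlternatingMap.alternatizeUncurryFin_apply, Fin.sum_univ_succ,
    removeNth_one_two, removeNth_one_three, removeNth_two_three, bracket_apply,
    h u v, h u w, h v w]
  ring

/-- `(Iω)(u₁, …) = ω(I u₁, …)`. -/
def pullI {n : ℕ} (ω : Form n) : Form n := fun x => (ω x).compContinuousLinearMap I

/-- `(I⁻¹ω)(u₁, …) = ω(I⁻¹ u₁, …)`, where `I⁻¹ = -I`. -/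
def pullIinv {n : ℕ} (ω : Form n) : Form n := fun x => (ω x).compContinuousLinearMap (-I)

/-- `dᶜ = I⁻¹ ∘ d ∘ I`, which equals `i (∂̄ - ∂)`. -/
def dc {n : ℕ} (ω : Form (n + 1)) : Form (n + 2) := pullIinv (d (pullI ω))

/-- `∂ = ½ (d + i dᶜ)`. -/
def del {n : ℕ} (ω : Form (n + 1)) : Form (n + 2) :=
  (1 / 2 : ℂ) • (d ω + Complex.I • dc ω)

/-- `∂̄ = ½ (d - i dᶜ)`. -/
def delbar {n : ℕ} (ω : Form (n + 1)) : Form (n + 2) :=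
  (1 / 2 : ℂ) • (d ω - Complex.I • dc ω)

/-- Forms of type `(1,0)`. -/
def IsType10 (ω : Form 1) : Prop := ∀ x u, ω x ![I u] = Complex.I * ω x ![u]

/-- Forms of type `(0,1)`. -/
def IsType01 (ω : Form 1) : Prop := ∀ x u, ω x ![I u] = -Complex.I * ω x ![u]

/-- The space `∂ Ω^{0,1} + ∂̄ Ω^{1,0}`, spanned by the `∂α` with `α` a smooth `(0,1)`-form on
`SO(9)` and the `∂̄β` with `β` a smooth `(1,0)`-form. -/
def aeppliExact : Submodule ℂ (Form 2) :=
  Submodule.span ℂ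
    ({ω | ∃ α : Form 1, IsSmooth α ∧ IsType01 α ∧ ω = del α} ∪
      {ω | ∃ β : Form 1, IsSmooth β ∧ IsType10 β ∧ ω = delbar β})

/-- The class of a form modulo `∂ Ω^{0,1} + ∂̄ Ω^{1,0}`. For a smooth `∂∂̄`-closed `(1,1)`-form this
is its Aeppli class, the Aeppli cohomology being the space of all such classes. -/
def aeppliClass (ω : Form 2) : Form 2 ⧸ aeppliExact := Submodule.Quotient.mk ω

/-! ### Left-invariant metrics -/

/-- A complex-valued real-linear functional on `so(9)` as a left-invariant `1`-form. -/
def oneForm (α : 𝔤 →L[ℝ] ℂ) : Alt 1 := ContinuousAlternatingMap.ofSubsingleton ℝ 𝔤 ℂ 0 α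

/-- The wedge product of two `1`-forms, `(α ∧ β)(u, v) = α(u) β(v) - α(v) β(u)`. -/
def wedge (α β : 𝔤 →L[ℝ] ℂ) : Alt 2 :=
  ContinuousAlternatingMap.alternatizeUncurryFin (α.smulRight (oneForm β))

theorem wedge_apply (α β : 𝔤 →L[ℝ] ℂ) (u v : 𝔤) :
    wedge α β ![u, v] = α u * β v - α v * β u := by
  simp [wedge, oneForm, ContinuousAlternatingMap.alternatizeUncurryFin_apply, Fin.sum_univ_two,
    removeNth_one_two]
  ring

/-- A left-invariant metric on `SO(9)` is an inner product on `so(9)`. It is `I`-Hermitian if `I`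
is an isometry. -/
structure IsHermitianMetric (g : LinearMap.BilinForm ℝ 𝔤) : Prop where
  symm : ∀ u v, g u v = g v u
  pos : ∀ u, u ≠ 0 → 0 < g u u
  herm : ∀ u v, g (I u) (I v) = g u v

/-- The fundamental form `F(u, v) = g(I u, v)` of an `I`-Hermitian metric. It is defined for all
bilinear forms as the alternating form `½ (g(I u, v) - g(I v, u))`. -/
def fundamentalForm (g : LinearMap.BilinForm ℝ 𝔤) : Alt 2 :=
  (1 / 2 : ℂ) • ContinuousAlternatingMap.alternatizeUncurryFin
    (LinearMap.toContinuousLinearMap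
      { toFun := fun u => oneForm
          (Complex.ofRealCLM.comp (LinearMap.toContinuousLinearMap (g (I u))))
        map_add' := fun u v => by ext w; simp [oneForm]
        map_smul' := fun c u => by ext w; simp [oneForm] } : 𝔤 →L[ℝ] Alt 1)

theorem fundamentalForm_apply {g : LinearMap.BilinForm ℝ 𝔤} (hg : IsHermitianMetric g)
    (hI : ∀ u, I (I u) = -u) (u v : 𝔤) : fundamentalForm g ![u, v] = g (I u) v := by
  have h : g (I v) u = -g (I u) v := by
    rw [← hg.herm (I v) u, hI, map_neg, LinearMap.neg_apply, hg.symm]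
  simp [fundamentalForm, oneForm, ContinuousAlternatingMap.alternatizeUncurryFin_apply,
    Fin.sum_univ_two, removeNth_one_two, h]
  ring

/-- A left-invariant metric is SKT if its fundamental form is `∂∂̄`-closed. -/
def IsSKT (g : LinearMap.BilinForm ℝ 𝔤) : Prop :=
  del (delbar (leftInv (fundamentalForm g))) = 0

/-- The maximal torus `T`, consisting of the exponentials of the span of `iH₁, …, iH₄`. -/
def torus : Set G := {h | ∃ H ∈ Submodule.span ℝ (Set.range tor), h = exp H}

/-- Invariance of a left-invariant metric under the right translations `R_h`, `h ∈ T`: since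
`x u h = x h (h⁻¹ u h)`, the metric `R_h^* g` is the left-invariant metric with value
`g(Ad(h⁻¹) u, Ad(h⁻¹) v)`. -/
def IsRightTorusInvariant (g : LinearMap.BilinForm ℝ 𝔤) : Prop :=
  ∀ h ∈ torus, ∀ u v, g (Ad h⁻¹ u) (Ad h⁻¹ v) = g u v

/-- The diagonal left-invariant symmetric form `Re ∑ b_k φ_k φ̄_k`, for which the frame is orthogonal
and both vectors of the `k`-th pair have square length `b_k`. -/
def diagMetric (b : Fin 18 → ℝ) : LinearMap.BilinForm ℝ 𝔤 :=
  ∑ k, b k • (LinearMap.BilinForm.linMulLin (coord (frame k).1).toLinearMap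
        (coord (frame k).1).toLinearMap +
      LinearMap.BilinForm.linMulLin (coord (frame k).2).toLinearMap
        (coord (frame k).2).toLinearMap)

/-- The bi-invariant metric `-B/14`, where `B` is the Killing form of `so(9)`; it is normalised so
that the frame is orthonormal. -/
def killingMetric : LinearMap.BilinForm ℝ 𝔤 := -(1 / 14 : ℝ) • killingForm ℝ 𝔤

/-- The five-parameter family of coefficients `(b_1, …, b_18)`; the parameters are
`p = (b_6, b_15, b_16, b_17, b_18)`. -/
def family (p : Fin 5 → ℝ) : Fin 18 → ℝ :=
  let b6 := p 0
  let b15 := p 1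
  let b16 := p 2
  let b17 := p 3
  let b18 := p 4
  ![b16 - b17 + b18,
    b16 - b17 + b18,
    b6 + b15 - b16 + b17 - b18,
    b6 - b16 + 2 * b17 - b18,
    b6 - b16 + b17,
    b6,
    2 * b6 + b15 - 3 * b16 + 4 * b17 - 3 * b18,
    2 * b6 + b15 - 3 * b16 + 3 * b17 - 2 * b18,
    2 * b6 + b15 - 2 * b16 + 2 * b17 - 2 * b18,
    2 * b6 - 3 * b16 + 4 * b17 - 2 * b18,
    2 * b6 - 2 * b16 + 3 * b17 - 2 * b18,
    2 * b6 - 2 * b16 + 2 * b17 - b18,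
    b15 + b16 - 2 * b17 + b18,
    b15 + b16 - b17,
    b15,
    b16,
    b17,
    b18]

/-- The coefficient `b_16 - b_17 + b_18`. -/
def scale (p : Fin 5 → ℝ) : ℝ := p 2 - p 3 + p 4

end SO9

end

open SO9

noncomputable section

namespace SO9

/-! ### The trace form and the elementary skew matrices -/

/-! Everything is measured against the ad-invariant form `coord u v = -½ tr(uv)`, which is also the
Killing metric divided by -14 and for which the frame is orthonormal. A single torus element
`genTor` takes distinct positive values on the positive roots, so `ad genTor` alone separates the
root planes. This gives the orthonormality of the frame, the integrability of `I` (a sum of positive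
roots is positive, and `I` is the quarter turn on vectors of positive frequency), and the diagonal
shape of a torus-invariant metric on the root planes.

For a Hermitian metric, `∂∂̄F` is a multiple of `dT + I(dT)`, where `T = dᶜF` (`isSKT_iff`). The
twelve relations among the coefficients say that `b` is an affine function of the root, `b_α = scale
+ ⟨slope, α⟩`, with value `scale` on the torus pairs (`family_eq`). The linear part contributes to
`F` the 2-forms `coord (tor j) [u, v]`, which are exact. Hence `dF`, and with it `T`, is `scale`
times that of the Killing metric. For the latter, `T` is the Cartan 3-form, which is closed, so
every member of the family is SKT. The exact terms are of type (1,1) with primitives in the span of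
`φ₁, φ₂` and their conjugates, which gives the explicit formula and the Aeppli class.

Conversely, let `g` be torus-invariant and SKT. Evaluating the SKT equation on `(X_α, Y_α, X_β,
Y_β)` involves the coroots `[X_α, Y_α]` in the torus. When neither `α + β` nor `α - β` is a root, it
says that the coroots are `g`-orthogonal; with the isometry `I` this forces `g` on the torus to be a
multiple `s` of the standard form (`metric_tor`). When only the sum is a root, it says `b_{α+β} =
b_α + b_β + s⟨α, β⟩` (`skt_sum_equation`). Eleven such relations and one for a pair of short roots
determine all coefficients from five of them (`eq_family`). -/

theorem coord_apply (u v : 𝔤) : coord u v = -(1 / 2) * Matrix.trace (toMat u * toMat v) := rfl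

theorem coord_comm (u v : 𝔤) : coord u v = coord v u := by
  rw [coord_apply, coord_apply, Matrix.trace_mul_comm]

theorem coord_add_left (u v w : 𝔤) : coord (u + v) w = coord u w + coord v w := by
  rw [coord_comm, map_add, coord_comm u, coord_comm v]

theorem coord_smul_left (c : ℝ) (u w : 𝔤) : coord (c • u) w = c * coord u w := by
  rw [coord_comm, map_smul, coord_comm u, smul_eq_mul]

theorem coord_neg_left (u w : 𝔤) : coord (-u) w = -coord u w := by
  rw [coord_comm, map_neg, coord_comm u]

theorem coord_sub_left (u v w : 𝔤) : coord (u - v) w = coord u w - coord v w := by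
  rw [coord_comm, map_sub, coord_comm u, coord_comm v]

theorem coord_zero_left (w : 𝔤) : coord 0 w = 0 := by rw [coord_comm, map_zero]

/-- The trace form is invariant. -/
theorem coord_lie (u v w : 𝔤) : coord ⁅u, v⁆ w = coord u ⁅v, w⁆ := by
  simp only [coord_apply, toMat_lie, sub_mul, mul_sub, Matrix.trace_sub]
  rw [Matrix.mul_assoc, Matrix.mul_assoc, Matrix.trace_mul_comm (toMat v) (toMat u * toMat w),
    Matrix.mul_assoc]

theorem toMat_R (i j : Fin 9) : toMat (R i j) = Matrix.single i j 1 - Matrix.single j i 1 := rfl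

theorem toMat_swap (u : 𝔤) (i j : Fin 9) : toMat u j i = -toMat u i j :=
  congrFun (congrFun (transpose_coe u) i) j

theorem coord_R (i j : Fin 9) (v : 𝔤) : coord (R i j) v = toMat v i j := by
  rw [coord_apply, toMat_R, sub_mul, Matrix.trace_sub, Matrix.trace_single_mul,
    Matrix.trace_single_mul, toMat_swap v i j]
  ring

theorem R_swap (i j : Fin 9) : R j i = -R i j :=
  toMat_injective (by simp [toMat_R])

theorem R_self (i : Fin 9) : R i i = 0 := toMat_injective (by simp [toMat_R])

theorem toMat_R_apply (i j k l : Fin 9) :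
    toMat (R i j) k l = (if i = k ∧ j = l then 1 else 0) - (if j = k ∧ i = l then 1 else 0) := by
  simp [toMat_R, Matrix.single_apply]

theorem lie_R (i j k l : Fin 9) :
    ⁅R i j, R k l⁆ = (if j = k then R i l else 0) + (if i = l then R j k else 0)
      - (if i = k then R j l else 0) - (if j = l then R i k else 0) := by
  have h : ∀ a b c d : Fin 9, (Matrix.single a b 1 * Matrix.single c d 1 : Matrix _ _ ℝ) =
      if b = c then Matrix.single a d 1 else 0 := by
    intro a b c d
    split_ifs with h
    · subst h; simp
    · simp [h]
  apply toMat_injective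
  simp only [toMat_lie, toMat_R, sub_mul, mul_sub, h, map_add, map_sub, apply_ite toMat, map_zero,
    eq_comm (a := l), eq_comm (a := k)]
  split_ifs <;> abel

/-- Both `u_ij` and `R i j` change sign when the indices are exchanged, so the double sum counts
each pair twice; hence the factor 1/2. -/
theorem eq_sum_R (u : 𝔤) : u = (1 / 2 : ℝ) • ∑ i, ∑ j, toMat u i j • R i j := by
  apply toMat_injective
  have h : ∑ i, ∑ j, toMat u i j • Matrix.single i j (1 : ℝ) = toMat u := by
    conv_rhs => rw [Matrix.matrix_eq_sum_single (toMat u)]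
    simp [Matrix.smul_single]
  have h' : ∑ i, ∑ j, toMat u i j • Matrix.single j i (1 : ℝ) = -toMat u := by
    rw [← transpose_coe, Finset.sum_comm, Matrix.matrix_eq_sum_single (toMat u)ᵀ]
    simp [Matrix.smul_single]
  simp only [map_smul, map_sum, toMat_R, smul_sub, Finset.sum_sub_distrib, h, h']
  module


/-! ### The weights of the frame -/

/-- The first vectors of the frame pairs. -/
abbrev eX (k : Fin 18) : 𝔤 := (frame k).1

/-- The second vectors of the frame pairs. -/
abbrev eY (k : Fin 18) : 𝔤 := (frame k).2

theorem fstIx_inj : ∀ i j, fstIx i = fstIx j ↔ i = j := by decide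

theorem sndIx_inj : ∀ i j, sndIx i = sndIx j ↔ i = j := by decide

theorem fstIx_ne_sndIx : ∀ i j, fstIx i ≠ sndIx j := by decide

theorem sndIx_ne_fstIx : ∀ i j, sndIx i ≠ fstIx j := by decide

theorem fstIx_ne_eight : ∀ i, fstIx i ≠ 8 := by decide

theorem sndIx_ne_eight : ∀ i, sndIx i ≠ 8 := by decide

theorem eight_ne_fstIx : ∀ i, 8 ≠ fstIx i := by decide

theorem eight_ne_sndIx : ∀ i, 8 ≠ sndIx i := by decide

theorem lie_tor_tor (i j : Fin 4) : ⁅tor i, tor j⁆ = 0 := by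
  by_cases h : i = j
  · subst h; simp
  · simp [tor, lie_R, fstIx_inj, sndIx_inj, fstIx_ne_sndIx, sndIx_ne_fstIx, h]

theorem lie_tor_shortRoot (i j : Fin 4) :
    ⁅tor i, (shortRoot j).1⁆ = (if i = j then 1 else 0 : ℝ) • (shortRoot j).2 ∧
    ⁅tor i, (shortRoot j).2⁆ = -(if i = j then 1 else 0 : ℝ) • (shortRoot j).1 := by
  by_cases h : i = j
  · subst h
    simp [tor, shortRoot, lie_R, fstIx_ne_sndIx, sndIx_ne_fstIx, fstIx_ne_eight, sndIx_ne_eight]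
  · simp [tor, shortRoot, lie_R, fstIx_inj, sndIx_inj, fstIx_ne_sndIx, sndIx_ne_fstIx,
      fstIx_ne_eight, sndIx_ne_eight, h]

theorem lie_tor_sumRoot (i j k : Fin 4) (hjk : j ≠ k) :
    ⁅tor i, (sumRoot j k).1⁆ =
      ((if i = j then 1 else 0) + (if i = k then 1 else 0) : ℝ) • (sumRoot j k).2 ∧
    ⁅tor i, (sumRoot j k).2⁆ =
      -((if i = j then 1 else 0) + (if i = k then 1 else 0) : ℝ) • (sumRoot j k).1 := by
  have hkj := hjk.symm
  by_cases h : i = j <;> by_cases h' : i = k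
  · exact absurd (h.symm.trans h') hjk
  · subst h
    simp [tor, sumRoot, lie_R, fstIx_inj, sndIx_inj, fstIx_ne_sndIx, sndIx_ne_fstIx, hjk]
    constructor <;> module
  · subst h'
    simp [tor, sumRoot, lie_R, fstIx_inj, sndIx_inj, fstIx_ne_sndIx, sndIx_ne_fstIx, hkj,
      R_swap (fstIx j), R_swap (sndIx j)]
    constructor <;> module
  · simp [tor, sumRoot, lie_R, fstIx_inj, sndIx_inj, fstIx_ne_sndIx, sndIx_ne_fstIx, h, h']

theorem lie_tor_diffRoot (i j k : Fin 4) (hjk : j ≠ k) :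
    ⁅tor i, (diffRoot j k).1⁆ =
      ((if i = j then 1 else 0) - (if i = k then 1 else 0) : ℝ) • (diffRoot j k).2 ∧
    ⁅tor i, (diffRoot j k).2⁆ =
      -((if i = j then 1 else 0) - (if i = k then 1 else 0) : ℝ) • (diffRoot j k).1 := by
  have hkj := hjk.symm
  by_cases h : i = j <;> by_cases h' : i = k
  · exact absurd (h.symm.trans h') hjk
  · subst h
    simp [tor, diffRoot, lie_R, fstIx_inj, sndIx_inj, fstIx_ne_sndIx, sndIx_ne_fstIx, hjk]
    constructor <;> module
  · subst h'
    simp [tor, diffRoot, lie_R, fstIx_inj, sndIx_inj, fstIx_ne_sndIx, sndIx_ne_fstIx, hkj,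
      R_swap (fstIx j), R_swap (sndIx j)]
    module
  · simp [tor, diffRoot, lie_R, fstIx_inj, sndIx_inj, fstIx_ne_sndIx, sndIx_ne_fstIx, h, h']

/-- The weights of the torus on the frame pairs: zero on the torus, then the positive roots. -/
def wt : Fin 18 → Fin 4 → ℝ :=
  ![![0, 0, 0, 0], ![0, 0, 0, 0], ![1, 0, 0, 0], ![0, 1, 0, 0], ![0, 0, 1, 0], ![0, 0, 0, 1],
    ![1, 1, 0, 0], ![1, 0, 1, 0], ![1, 0, 0, 1], ![0, 1, 1, 0], ![0, 1, 0, 1], ![0, 0, 1, 1],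
    ![1, -1, 0, 0], ![1, 0, -1, 0], ![1, 0, 0, -1], ![0, 1, -1, 0], ![0, 1, 0, -1], ![0, 0, 1, -1]]

theorem wt_natAdd (k : Fin 16) : wt (Fin.natAdd 2 k) = posRoot k := by
  fin_cases k <;> rfl

theorem lie_tor_frame (i : Fin 4) (k : Fin 18) :
    ⁅tor i, eX k⁆ = wt k i • eY k ∧ ⁅tor i, eY k⁆ = -wt k i • eX k := by
  have ht : ∀ j l (c : ℝ), c = 0 →
      ⁅tor i, tor j⁆ = c • tor l ∧ ⁅tor i, tor l⁆ = -c • tor j := by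
    rintro j l c rfl; simp [lie_tor_tor]
  have hs : ∀ j (c : ℝ), c = (if i = j then 1 else 0) →
      ⁅tor i, (shortRoot j).1⁆ = c • (shortRoot j).2 ∧
      ⁅tor i, (shortRoot j).2⁆ = -c • (shortRoot j).1 := by
    rintro j c rfl; exact lie_tor_shortRoot i j
  have hp : ∀ j l (c : ℝ), j ≠ l → c = ((if i = j then 1 else 0) + (if i = l then 1 else 0)) →
      ⁅tor i, (sumRoot j l).1⁆ = c • (sumRoot j l).2 ∧
      ⁅tor i, (sumRoot j l).2⁆ = -c • (sumRoot j l).1 := by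
    rintro j l c h rfl; exact lie_tor_sumRoot i j l h
  have hd : ∀ j l (c : ℝ), j ≠ l → c = ((if i = j then 1 else 0) - (if i = l then 1 else 0)) →
      ⁅tor i, (diffRoot j l).1⁆ = c • (diffRoot j l).2 ∧
      ⁅tor i, (diffRoot j l).2⁆ = -c • (diffRoot j l).1 := by
    rintro j l c h rfl; exact lie_tor_diffRoot i j l h
  fin_cases k
  · exact ht 0 1 _ (by fin_cases i <;> rfl)
  · exact ht 2 3 _ (by fin_cases i <;> rfl)
  · exact hs 0 _ (by fin_cases i <;> simp [wt])
  · exact hs 1 _ (by fin_cases i <;> simp [wt])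
  · exact hs 2 _ (by fin_cases i <;> simp [wt])
  · exact hs 3 _ (by fin_cases i <;> simp [wt])
  · exact hp 0 1 _ (by decide) (by fin_cases i <;> simp [wt])
  · exact hp 0 2 _ (by decide) (by fin_cases i <;> simp [wt])
  · exact hp 0 3 _ (by decide) (by fin_cases i <;> simp [wt])
  · exact hp 1 2 _ (by decide) (by fin_cases i <;> simp [wt])
  · exact hp 1 3 _ (by decide) (by fin_cases i <;> simp [wt])
  · exact hp 2 3 _ (by decide) (by fin_cases i <;> simp [wt])
  · exact hd 0 1 _ (by decide) (by fin_cases i <;> simp [wt])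
  · exact hd 0 2 _ (by decide) (by fin_cases i <;> simp [wt])
  · exact hd 0 3 _ (by decide) (by fin_cases i <;> simp [wt])
  · exact hd 1 2 _ (by decide) (by fin_cases i <;> simp [wt])
  · exact hd 1 3 _ (by decide) (by fin_cases i <;> simp [wt])
  · exact hd 2 3 _ (by decide) (by fin_cases i <;> simp [wt])

/-- A torus element on which the positive roots take distinct positive values. -/
def genTor : 𝔤 := (27 : ℝ) • tor 0 + (9 : ℝ) • tor 1 + (3 : ℝ) • tor 2 + tor 3

/-- The values of the weights on `genTor`. -/
def genWt : Fin 18 → ℕ := ![0, 0, 27, 9, 3, 1, 36, 30, 28, 12, 10, 4, 18, 24, 26, 6, 8, 2]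

theorem wt_genTor (k : Fin 18) : 27 * wt k 0 + 9 * wt k 1 + 3 * wt k 2 + wt k 3 = genWt k := by
  fin_cases k <;> simp [wt, genWt] <;> norm_num

theorem lie_genTor_frame (k : Fin 18) :
    ⁅genTor, eX k⁆ = (genWt k : ℝ) • eY k ∧ ⁅genTor, eY k⁆ = -(genWt k : ℝ) • eX k := by
  rw [← wt_genTor]
  simp only [genTor, add_lie, smul_lie, lie_tor_frame]
  constructor <;> module

/-- The coefficients 27, 9, 3, 1 read a weight with entries in {-1, 0, 1} as a balanced ternary
number. Distinct weights thus have distinct values, and the only coincidence is between the two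
torus pairs, both of weight zero. -/
theorem genWt_inj : ∀ k l, genWt k = genWt l → k = l ∨ k < 2 ∧ l < 2 := by decide

theorem genWt_pos : ∀ k, 2 ≤ k → 0 < genWt k := by decide

/-! ### The frame is an orthonormal basis -/

/-- The planes of `f^j + f^k` and `f^j - f^k` together span the four `R`'s joining the blocks `j`
and `k`; the two bases differ by rotations through 45 degrees and signs, so the cross terms cancel.
-/
theorem expand_roots (j k : Fin 4) (u : 𝔤) :
    coord (sumRoot j k).1 u • (sumRoot j k).1 + coord (sumRoot j k).2 u • (sumRoot j k).2 +
      (coord (diffRoot j k).1 u • (diffRoot j k).1 +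
        coord (diffRoot j k).2 u • (diffRoot j k).2) =
    toMat u (fstIx j) (fstIx k) • R (fstIx j) (fstIx k) +
      toMat u (sndIx j) (sndIx k) • R (sndIx j) (sndIx k) +
      toMat u (fstIx j) (sndIx k) • R (fstIx j) (sndIx k) +
      toMat u (sndIx j) (fstIx k) • R (sndIx j) (fstIx k) := by
  have h2 : (√2 / 2) * (√2 / 2) = (1 / 2 : ℝ) := by
    have := Real.mul_self_sqrt (show (0 : ℝ) ≤ 2 by norm_num); linarith
  have h3 : ∀ (x : ℝ) (v : 𝔤), (√2 / 2 * x) • (√2 / 2) • v = (1 / 2 * x) • v := by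
    intro x v; rw [smul_smul, mul_right_comm, h2]
  simp only [sumRoot, diffRoot, coord_smul_left, coord_add_left, coord_sub_left, coord_neg_left,
    coord_R, h3]
  module

theorem sum_univ_eighteen {M : Type*} [AddCommMonoid M] (f : Fin 18 → M) :
    ∑ k, f k = f 0 + f 1 + f 2 + f 3 + f 4 + f 5 + f 6 + f 7 + f 8 + f 9 + f 10 + f 11 + f 12 +
      f 13 + f 14 + f 15 + f 16 + f 17 := by
  iterate 10 rw [Fin.sum_univ_castSucc]
  rw [Fin.sum_univ_eight]
  rfl

theorem frame_table :
    frame 0 = (tor 0, tor 1) ∧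
    frame 1 = (tor 2, tor 3) ∧
    frame 2 = shortRoot 0 ∧
    frame 3 = shortRoot 1 ∧
    frame 4 = shortRoot 2 ∧
    frame 5 = shortRoot 3 ∧
    frame 6 = sumRoot 0 1 ∧
    frame 7 = sumRoot 0 2 ∧
    frame 8 = sumRoot 0 3 ∧
    frame 9 = sumRoot 1 2 ∧
    frame 10 = sumRoot 1 3 ∧
    frame 11 = sumRoot 2 3 ∧
    frame 12 = diffRoot 0 1 ∧
    frame 13 = diffRoot 0 2 ∧
    frame 14 = diffRoot 0 3 ∧
    frame 15 = diffRoot 1 2 ∧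
    frame 16 = diffRoot 1 3 ∧
    frame 17 = diffRoot 2 3 := by
  refine ⟨rfl, rfl, rfl, rfl, rfl, rfl, rfl, rfl, rfl, rfl, rfl, rfl, rfl, rfl, rfl, rfl, rfl, rfl⟩

/-- Completeness is proved as a direct identity, before orthonormality is known: the torus,
short-root and block contributions together run once through all `R i j` with `i < j`. -/
theorem eq_sum_frame (u : 𝔤) : u = ∑ k, (coord (eX k) u • eX k + coord (eY k) u • eY k) := by
  have h1 : ∑ k, (coord (eX k) u • eX k + coord (eY k) u • eY k) =
      ∑ j, coord (tor j) u • tor j +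
      ∑ j, (coord (shortRoot j).1 u • (shortRoot j).1 +
        coord (shortRoot j).2 u • (shortRoot j).2) +
      ∑ p ∈ ({(0, 1), (0, 2), (0, 3), (1, 2), (1, 3), (2, 3)} : Finset (Fin 4 × Fin 4)),
        (coord (sumRoot p.1 p.2).1 u • (sumRoot p.1 p.2).1 +
          coord (sumRoot p.1 p.2).2 u • (sumRoot p.1 p.2).2 +
        (coord (diffRoot p.1 p.2).1 u • (diffRoot p.1 p.2).1 +
        coord (diffRoot p.1 p.2).2 u • (diffRoot p.1 p.2).2)) := by
    rw [Finset.sum_insert (by decide), Finset.sum_insert (by decide), Finset.sum_insert (by decide),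
      Finset.sum_insert (by decide), Finset.sum_insert (by decide), Finset.sum_singleton]
    rw [sum_univ_eighteen, Fin.sum_univ_four, Fin.sum_univ_four]
    simp only [eX, eY, frame_table]
    abel
  rw [h1]
  simp only [expand_roots]
  rw [Finset.sum_insert (by decide), Finset.sum_insert (by decide), Finset.sum_insert (by decide),
      Finset.sum_insert (by decide), Finset.sum_insert (by decide), Finset.sum_singleton]
  conv_lhs => rw [eq_sum_R u]
  have hR : ∀ i j, i < j → toMat u j i • R j i = toMat u i j • R i j := by
    intro i j _; rw [toMat_swap, R_swap, smul_neg, neg_smul, neg_neg]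
  have h2 : ∑ i, ∑ j, toMat u i j • R i j =
      (2 : ℝ) • ∑ i, ∑ j, if i < j then toMat u i j • R i j else 0 := by
    have h3 : ∀ i j, toMat u i j • R i j = (if i < j then toMat u i j • R i j else 0) +
        (if j < i then toMat u j i • R j i else 0) := by
      intro i j
      rcases lt_trichotomy i j with h | h | h
      · simp [h, h.not_gt]
      · subst h; simp [R_self]
      · simp [h, h.not_gt, hR j i h]
    simp_rw [two_smul]
    nth_rewrite 3 [Finset.sum_comm]
    rw [← Finset.sum_add_distrib]
    exact Finset.sum_congr rfl fun i _ => by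
      rw [← Finset.sum_add_distrib]
      exact Finset.sum_congr rfl fun j _ => h3 i j
  rw [h2, ← mul_smul, show (1 / 2 * 2 : ℝ) = 1 by norm_num, one_smul]
  simp only [Fin.sum_univ_succ, Fin.sum_univ_zero, tor, shortRoot, coord_neg_left, coord_R,
    smul_neg, neg_smul, neg_neg, fstIx, sndIx]
  simp
  abel

/-! ### The Killing form -/

/-- The projection of a matrix to its skew-symmetric part. -/
def skew : Matrix (Fin 9) (Fin 9) ℝ →ₗ[ℝ] 𝔤 where
  toFun A := ⟨(1 / 2 : ℝ) • (A - Aᵀ), by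
    rw [LieAlgebra.Orthogonal.mem_so, Matrix.transpose_smul, Matrix.transpose_sub,
      Matrix.transpose_transpose, ← smul_neg, neg_sub]⟩
  map_add' A B := Subtype.ext (by
    change (1 / 2 : ℝ) • (A + B - (A + B)ᵀ) = (1 / 2 : ℝ) • (A - Aᵀ) + (1 / 2 : ℝ) • (B - Bᵀ)
    rw [Matrix.transpose_add]; module)
  map_smul' c A := Subtype.ext (by
    change (1 / 2 : ℝ) • (c • A - (c • A)ᵀ) = c • (1 / 2 : ℝ) • (A - Aᵀ)
    rw [Matrix.transpose_smul]; module)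

theorem toMat_skew (A : Matrix (Fin 9) (Fin 9) ℝ) : toMat (skew A) = (1 / 2 : ℝ) • (A - Aᵀ) := rfl

theorem skew_toMat (u : 𝔤) : skew (toMat u) = u := by
  apply toMat_injective
  rw [toMat_skew, transpose_coe]; module

theorem trace_matrix_end {n : Type*} [Fintype n] [DecidableEq n]
    (L : Matrix n n ℝ →ₗ[ℝ] Matrix n n ℝ) :
    LinearMap.trace ℝ _ L = ∑ i, ∑ j, L (Matrix.single i j 1) i j := by
  rw [LinearMap.trace_eq_matrix_trace ℝ (Matrix.stdBasis ℝ n n), Matrix.trace,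
    Fintype.sum_prod_type]
  refine Finset.sum_congr rfl fun i _ => Finset.sum_congr rfl fun j _ => ?_
  rw [Matrix.diag_apply, LinearMap.toMatrix_apply, Matrix.stdBasis_eq_single]
  rfl

theorem trace_mat_eq_zero (u : 𝔤) : ∑ i, toMat u i i = 0 :=
  Finset.sum_eq_zero fun i _ => by have := toMat_swap u i i; linarith

theorem mul_single_mul_apply {n : Type*} [Fintype n] [DecidableEq n] (a b : Matrix n n ℝ)
    (i j k l : n) : (a * Matrix.single i j (1 : ℝ) * b : Matrix n n ℝ) k l = a k i * b j l := by
  rw [Matrix.mul_assoc, Matrix.mul_apply, Finset.sum_eq_single i, Matrix.single_mul_apply_same,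
    one_mul]
  · intro m _ hm
    rw [Matrix.single_mul_apply_of_ne _ _ _ _ _ hm, mul_zero]
  · simp

/-- Since `skew ∘ toMat` is the identity, the trace on `𝔤` equals the trace of `toMat ∘ ad u ∘ ad v
∘ skew` on all matrices, computed on matrix units. With `t = tr(uv)` the terms add up to `½(9t + 9t
- 2t - 2t) = 7t`. -/
theorem killingForm_eq (u v : 𝔤) : killingForm ℝ 𝔤 u v = 7 * Matrix.trace (toMat u * toMat v) := by
  rw [killingForm_apply_apply]
  have h1 : LieAlgebra.ad ℝ 𝔤 u ∘ₗ LieAlgebra.ad ℝ 𝔤 v =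
      ((LieAlgebra.ad ℝ 𝔤 u ∘ₗ LieAlgebra.ad ℝ 𝔤 v) ∘ₗ skew) ∘ₗ toMat := by
    ext w; simp [skew_toMat]
  rw [h1, LinearMap.trace_comp_comm', trace_matrix_end]
  have h2 : ∀ i j, (toMat ∘ₗ (LieAlgebra.ad ℝ 𝔤 u ∘ₗ LieAlgebra.ad ℝ 𝔤 v) ∘ₗ skew)
      (Matrix.single i j 1) i j =
      1 / 2 * ((toMat u * toMat v) i i + (toMat v * toMat u) j j
        - toMat u i i * toMat v j j - toMat v i i * toMat u j j
        - (if i = j then (toMat u * toMat v) i j + (toMat v * toMat u) i j else 0)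
        - 2 * (toMat u i j * toMat v j i)) := by
    intro i j
    have h3 : (toMat ∘ₗ (LieAlgebra.ad ℝ 𝔤 u ∘ₗ LieAlgebra.ad ℝ 𝔤 v) ∘ₗ skew)
      (Matrix.single i j 1) =
        (1 / 2 : ℝ) • ((toMat u * toMat v) * Matrix.single i j 1 * 1
         + 1 * Matrix.single i j 1 * (toMat v * toMat u)
         - toMat u * Matrix.single i j 1 * toMat v - toMat v * Matrix.single i j 1 * toMat u
         - ((toMat u * toMat v) * Matrix.single j i 1 * 1
         + 1 * Matrix.single j i 1 * (toMat v * toMat u)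
         - toMat u * Matrix.single j i 1 * toMat v - toMat v * Matrix.single j i 1 * toMat u)) := by
      simp only [LinearMap.comp_apply, LieAlgebra.ad_apply, toMat_lie, toMat_skew,
        Matrix.transpose_single, mul_smul_comm, smul_mul_assoc, mul_one, one_mul]
      rw [← smul_sub, mul_smul_comm, smul_mul_assoc, ← smul_sub]
      congr 1
      noncomm_ring
    rw [h3]
    simp only [Matrix.smul_apply, Matrix.sub_apply, Matrix.add_apply, mul_single_mul_apply,
      Matrix.one_apply, smul_eq_mul]
    rw [toMat_swap v j i]
    by_cases hij : i = j
    · subst hij; simp only [if_true]; ring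
    · simp only [hij, if_true, if_false]; ring
  simp only [h2]
  simp only [← Finset.mul_sum, Finset.sum_sub_distrib, Finset.sum_add_distrib, Finset.sum_const,
    trace_mat_eq_zero, Finset.sum_ite_eq, Finset.mem_univ, if_true, ← Matrix.mul_apply]
  have h4 : ∑ i, (toMat v * toMat u) i i = ∑ i, (toMat u * toMat v) i i :=
    Matrix.trace_mul_comm _ _
  simp only [Finset.card_univ, Fintype.card_fin, h4, Matrix.trace, Matrix.diag_apply]
  simp only [← Finset.smul_sum]
  simp
  ring

theorem killingMetric_apply (u v : 𝔤) : killingMetric u v = coord u v := by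
  simp only [killingMetric, LinearMap.smul_apply, killingForm_eq, coord_apply, smul_eq_mul]
  ring

/-! ### Forms invariant under the torus -/

section InvariantForms

variable {g : LinearMap.BilinForm ℝ 𝔤}

/-- `ad genTor` rotates the two planes at different speeds. Invariance gives four linear equations
for the four inner products, and eliminating leaves each of them multiplied by the difference of the
squared speeds. -/
theorem orthogonal_of_genWt_ne (hT : ∀ u v, g ⁅genTor, u⁆ v + g u ⁅genTor, v⁆ = 0) {k l : Fin 18}
    (h : genWt k ≠ genWt l) : g (eX k) (eX l) = 0 ∧ g (eX k) (eY l) = 0 ∧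
      g (eY k) (eX l) = 0 ∧ g (eY k) (eY l) = 0 := by
  have h1 := hT (eX k) (eX l)
  have h2 := hT (eX k) (eY l)
  have h3 := hT (eY k) (eX l)
  have h4 := hT (eY k) (eY l)
  simp only [lie_genTor_frame, map_smul, LinearMap.smul_apply, smul_eq_mul] at h1 h2 h3 h4
  have hne : ((genWt k : ℝ) - genWt l) * (genWt k + genWt l) ≠ 0 := by
    refine mul_ne_zero (sub_ne_zero.2 (by exact_mod_cast h)) ?_
    have : genWt k + genWt l ≠ 0 := by omega
    exact_mod_cast this
  refine ⟨?_, ?_, ?_, ?_⟩ <;> refine mul_left_cancel₀ hne ?_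
  · linear_combination (-(genWt k : ℝ)) * h3 + (genWt l : ℝ) * h2
  · linear_combination (-(genWt k : ℝ)) * h4 - (genWt l : ℝ) * h1
  · linear_combination (genWt k : ℝ) * h1 + (genWt l : ℝ) * h4
  · linear_combination (genWt k : ℝ) * h2 - (genWt l : ℝ) * h3

theorem conformal_on_root_plane (hs : ∀ u v, g u v = g v u)
    (hT : ∀ u v, g ⁅genTor, u⁆ v + g u ⁅genTor, v⁆ = 0) {k : Fin 18} (h : 2 ≤ k) :
    g (eX k) (eY k) = 0 ∧ g (eY k) (eX k) = 0 ∧ g (eY k) (eY k) = g (eX k) (eX k) := by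
  have h1 := hT (eX k) (eX k)
  have h2 := hT (eX k) (eY k)
  simp only [lie_genTor_frame, map_smul, LinearMap.smul_apply, smul_eq_mul] at h1 h2
  have hne : (genWt k : ℝ) ≠ 0 := by exact_mod_cast (genWt_pos k h).ne'
  have h3 : g (eX k) (eY k) = 0 := by
    rw [hs (eY k)] at h1
    exact mul_left_cancel₀ hne (by linear_combination h1 / 2)
  exact ⟨h3, by rw [hs, h3], mul_left_cancel₀ hne (by linear_combination h2)⟩

end InvariantForms

/-! ### Orthonormality of the frame -/

theorem lie_coord_add (w u v : 𝔤) : coord ⁅w, u⁆ v + coord u ⁅w, v⁆ = 0 := by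
  rw [← lie_skew, coord_neg_left, coord_lie]; ring

theorem coord_tor (i j : Fin 4) : coord (tor i) (tor j) = if i = j then 1 else 0 := by
  simp only [tor, coord_neg_left, map_neg, coord_R, neg_neg, toMat_R_apply, fstIx_inj, sndIx_inj,
    fstIx_ne_sndIx, sndIx_ne_fstIx, and_self, if_false, sub_zero, eq_comm (a := j)]

theorem coord_eX_self (k : Fin 18) : coord (eX k) (eX k) = 1 := by
  have h2 : √2 * √2 = 2 := Real.mul_self_sqrt (by norm_num)
  have hs : ∀ j, coord (shortRoot j).1 (shortRoot j).1 = 1 := by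
    intro j; simp [shortRoot, coord_R, toMat_R_apply, eight_ne_fstIx]
  have hp : ∀ j l, j ≠ l → coord (sumRoot j l).1 (sumRoot j l).1 = 1 := by
    intro j l h
    simp [sumRoot, coord_R, coord_smul_left, coord_add_left, coord_neg_left, toMat_R_apply,
      fstIx_inj, sndIx_inj, fstIx_ne_sndIx, sndIx_ne_fstIx, h, h.symm]
    linear_combination h2 / 2
  have hd : ∀ j l, j ≠ l → coord (diffRoot j l).1 (diffRoot j l).1 = 1 := by
    intro j l h
    simp [diffRoot, coord_R, coord_smul_left, coord_sub_left, coord_neg_left, toMat_R_apply,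
      fstIx_inj, sndIx_inj, fstIx_ne_sndIx, sndIx_ne_fstIx, h, h.symm]
    linear_combination h2 / 2
  fin_cases k
  · exact (coord_tor 0 0).trans (if_pos rfl)
  · exact (coord_tor 2 2).trans (if_pos rfl)
  · exact hs 0
  · exact hs 1
  · exact hs 2
  · exact hs 3
  · exact hp 0 1 (by decide)
  · exact hp 0 2 (by decide)
  · exact hp 0 3 (by decide)
  · exact hp 1 2 (by decide)
  · exact hp 1 3 (by decide)
  · exact hp 2 3 (by decide)
  · exact hd 0 1 (by decide)
  · exact hd 0 2 (by decide)
  · exact hd 0 3 (by decide)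
  · exact hd 1 2 (by decide)
  · exact hd 1 3 (by decide)
  · exact hd 2 3 (by decide)

/-- The separation of root planes is applied to the Killing metric itself, so only unit length of
`eX k` and the torus block need a computation. -/
theorem coord_frame (k l : Fin 18) :
    coord (eX k) (eX l) = (if k = l then 1 else 0) ∧ coord (eX k) (eY l) = 0 ∧
    coord (eY k) (eX l) = 0 ∧ coord (eY k) (eY l) = (if k = l then 1 else 0) := by
  have hT : ∀ u v, killingMetric ⁅genTor, u⁆ v + killingMetric u ⁅genTor, v⁆ = 0 := by
    intro u v; rw [killingMetric_apply, killingMetric_apply, lie_coord_add]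
  have hs : ∀ u v, killingMetric u v = killingMetric v u := by
    intro u v; rw [killingMetric_apply, killingMetric_apply, coord_comm]
  by_cases h : genWt k = genWt l
  · rcases genWt_inj k l h with rfl | ⟨hk, hl⟩
    · by_cases hk : 2 ≤ k
      · have := conformal_on_root_plane hs hT hk
        simp only [killingMetric_apply] at this
        simp [this, coord_eX_self]
      · have hk' : k = 0 ∨ k = 1 := by revert k; decide
        rcases hk' with rfl | rfl <;> simp [eX, eY, frame, coord_tor]
    · have hk' : ∀ m : Fin 18, m < 2 → m = 0 ∨ m = 1 := by decide
      rcases hk' k hk with rfl | rfl <;> rcases hk' l hl with rfl | rfl <;>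
        simp [eX, eY, frame, coord_tor]
  · have hkl : k ≠ l := fun e => h (e ▸ rfl)
    have := orthogonal_of_genWt_ne hT h
    simp only [killingMetric_apply] at this
    simp [this, hkl]

theorem coord_self_eq (u v : 𝔤) :
    coord u v = ∑ k, (coord (eX k) u * coord (eX k) v + coord (eY k) u * coord (eY k) v) := by
  conv_lhs => rw [eq_sum_frame v]
  simp only [map_sum, map_add, map_smul, smul_eq_mul]
  exact Finset.sum_congr rfl fun k _ => by rw [coord_comm u, coord_comm u]; ring

theorem ext_coord {u v : 𝔤} (h : ∀ k, coord (eX k) u = coord (eX k) v ∧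
    coord (eY k) u = coord (eY k) v) : u = v := by
  rw [eq_sum_frame u, eq_sum_frame v]
  simp [h]

/-! ### The complex structure -/

theorem I_apply (u : 𝔤) : I u = ∑ k, (coord (eX k) u • eY k - coord (eY k) u • eX k) := by
  simp [I]

theorem coord_I (k : Fin 18) (u : 𝔤) :
    coord (eX k) (I u) = -coord (eY k) u ∧ coord (eY k) (I u) = coord (eX k) u := by
  constructor <;> simp [I_apply, coord_frame]

theorem I_I (u : 𝔤) : I (I u) = -u :=
  ext_coord fun k => by simp [coord_I]

theorem I_eX (k : Fin 18) : I (eX k) = eY k :=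
  ext_coord fun l => by simp [coord_I, coord_frame]

theorem I_eY (k : Fin 18) : I (eY k) = -eX k := by rw [← I_eX, I_I]

theorem coord_I_I (u v : 𝔤) : coord (I u) (I v) = coord u v := by
  rw [coord_self_eq, coord_self_eq u v]
  exact Finset.sum_congr rfl fun k _ => by simp only [coord_I]; ring

theorem coord_I_left (u v : 𝔤) : coord (I u) v = -coord u (I v) := by
  rw [← coord_I_I, I_I, coord_neg_left]

theorem coord_lie_tor (i : Fin 4) (k : Fin 18) (u : 𝔤) :
    coord (eX k) ⁅tor i, u⁆ = -wt k i * coord (eY k) u ∧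
    coord (eY k) ⁅tor i, u⁆ = wt k i * coord (eX k) u := by
  have h1 := lie_coord_add (tor i) (eX k) u
  have h2 := lie_coord_add (tor i) (eY k) u
  simp only [lie_tor_frame, coord_smul_left] at h1 h2
  constructor <;> linarith

theorem lie_tor_I (i : Fin 4) (u : 𝔤) : ⁅tor i, I u⁆ = I ⁅tor i, u⁆ :=
  ext_coord fun k => by simp [coord_lie_tor, coord_I]

/-! ### Integrability of `I` -/

theorem coord_lie_genTor (k : Fin 18) (u : 𝔤) :
    coord (eX k) ⁅genTor, u⁆ = -genWt k * coord (eY k) u ∧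
    coord (eY k) ⁅genTor, u⁆ = genWt k * coord (eX k) u := by
  have h1 := lie_coord_add genTor (eX k) u
  have h2 := lie_coord_add genTor (eY k) u
  simp only [lie_genTor_frame, coord_smul_left] at h1 h2
  constructor <;> linarith

/-- A vector on which `ad genTor` acts with a positive frequency `c` is rotated by `I`. -/
theorem eq_I_of_rotation {c : ℝ} (hc : 0 < c) {A B : 𝔤} (hA : ⁅genTor, A⁆ = c • B)
    (hB : ⁅genTor, B⁆ = -c • A) : B = I A := by
  refine ext_coord fun k => ?_
  have h1 := (coord_lie_genTor k A).1
  have h2 := (coord_lie_genTor k A).2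
  have h3 := (coord_lie_genTor k B).1
  have h4 := (coord_lie_genTor k B).2
  rw [hA, map_smul, smul_eq_mul] at h1 h2
  rw [hB, map_smul, smul_eq_mul] at h3 h4
  rw [(coord_I k A).1, (coord_I k A).2]
  -- The coordinates of `B - I A` in the `k`-th plane are annihilated by `c + genWt k`, which is
  -- positive because `c > 0` and no `genWt k` is negative.
  have hne : c + genWt k ≠ 0 := by positivity
  constructor <;> refine mul_left_cancel₀ hne ?_
  · linear_combination h1 - h4
  · linear_combination h2 + h3

/-- The two sides come from the real and imaginary parts of a bracket of root vectors, on which `ad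
genTor` has frequency `genWt k + genWt l`. This is positive unless both pairs lie in the torus,
where all brackets vanish. -/
theorem lie_eX_eX_sub (k l : Fin 18) :
    ⁅eX k, eY l⁆ + ⁅eY k, eX l⁆ = I (⁅eX k, eX l⁆ - ⁅eY k, eY l⁆) := by
  rcases Nat.eq_zero_or_pos (genWt k + genWt l) with h | h
  · have h0 : ∀ m, genWt m = 0 → m = 0 ∨ m = 1 := by decide
    rcases h0 k (by omega) with rfl | rfl <;> rcases h0 l (by omega) with rfl | rfl <;>
      simp [eX, eY, frame, lie_tor_tor]
  · refine eq_I_of_rotation (c := genWt k + genWt l) (by exact_mod_cast h) ?_ ?_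
    · simp only [lie_sub, leibniz_lie genTor, lie_genTor_frame, smul_lie, lie_smul]
      module
    · simp only [lie_add, leibniz_lie genTor, lie_genTor_frame, smul_lie, lie_smul]
      module

theorem ext_bilin_frame {V : Type*} [AddCommGroup V] [Module ℝ V] {B C : 𝔤 →ₗ[ℝ] 𝔤 →ₗ[ℝ] V}
    (hXX : ∀ k l, B (eX k) (eX l) = C (eX k) (eX l))
    (hXY : ∀ k l, B (eX k) (eY l) = C (eX k) (eY l))
    (hYX : ∀ k l, B (eY k) (eX l) = C (eY k) (eX l))
    (hYY : ∀ k l, B (eY k) (eY l) = C (eY k) (eY l)) (u v : 𝔤) : B u v = C u v := by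
  rw [eq_sum_frame u, eq_sum_frame v]
  simp only [map_sum, map_add, map_smul, LinearMap.sum_apply, LinearMap.add_apply,
    LinearMap.smul_apply, hXX, hXY, hYX, hYY]

/-- The Lie bracket as a bilinear map. -/
def lieBilin : 𝔤 →ₗ[ℝ] 𝔤 →ₗ[ℝ] 𝔤 := LieModule.toEnd ℝ 𝔤 𝔤

theorem lieBilin_apply (u v : 𝔤) : lieBilin u v = ⁅u, v⁆ := rfl

/-- Both sides are bilinear, and on each of the four kinds of frame pairs the identity is a
rearrangement of `lie_eX_eX_sub`. -/
theorem lie_I_I (u v : 𝔤) : ⁅I u, I v⁆ = ⁅u, v⁆ + I (⁅I u, v⁆ + ⁅u, I v⁆) := by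
  have h1 : ∀ k l, ⁅eY k, eY l⁆ = ⁅eX k, eX l⁆ + I (⁅eX k, eY l⁆ + ⁅eY k, eX l⁆) := by
    intro k l; rw [lie_eX_eX_sub, I_I]; abel
  have h2 : ∀ k l, I ⁅eX k, eX l⁆ = ⁅eX k, eY l⁆ + ⁅eY k, eX l⁆ + I ⁅eY k, eY l⁆ := by
    intro k l; rw [lie_eX_eX_sub, map_sub]; abel
  let J : 𝔤 →ₗ[ℝ] 𝔤 := I.toLinearMap
  have h := ext_bilin_frame (B := lieBilin.compl₁₂ J J)
    (C := lieBilin + (lieBilin.compl₁₂ J LinearMap.id + lieBilin.compl₁₂ LinearMap.id J).compr₂ J)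
    ?_ ?_ ?_ ?_ u v
  · simpa [lieBilin_apply, J] using h
  all_goals
    intro k l
    simp only [J, LinearMap.compl₁₂_apply, LinearMap.compr₂_apply, LinearMap.add_apply,
      lieBilin_apply, ContinuousLinearMap.coe_coe, LinearMap.id_apply, I_eX, I_eY,
      map_add, map_neg, LinearMap.neg_apply, neg_neg]
  · rw [h1]; simp only [map_add]; abel
  · rw [h2, h1 k l]; simp only [map_add, I_I]; abel
  · rw [h2, h1 k l]; simp only [map_add, I_I]; abel
  · rw [h1]; simp only [map_add]; abel

theorem nijenhuis_eq_zero (u v : 𝔤) : ⁅I u, I v⁆ - I ⁅I u, v⁆ - I ⁅u, I v⁆ - ⁅u, v⁆ = 0 := by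
  rw [lie_I_I, map_add]; abel

/-! ### The complex coframe -/

theorem φ_apply (k : Fin 18) (u : 𝔤) :
    φ k u = (coord (eX k) u : ℂ) + Complex.I * (coord (eY k) u : ℂ) := by
  simp [φ]

theorem φbar_apply (k : Fin 18) (u : 𝔤) :
    φbar k u = (coord (eX k) u : ℂ) - Complex.I * (coord (eY k) u : ℂ) := by
  simp [φbar, φ_apply, sub_eq_add_neg]

/-! ### Left-invariant forms -/

theorem leftDeriv_leftInv {n : ℕ} (ω : Alt n) (x : G) : leftDeriv (leftInv ω) x = 0 := by
  simp [leftDeriv, leftInv]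

theorem d_leftInv {n : ℕ} (ω : Alt (n + 1)) : d (leftInv ω) = leftInv (bracketPart ω) := by
  funext x
  have h : ContinuousAlternatingMap.alternatizeUncurryFin (0 : 𝔤 →L[ℝ] Alt (n + 1)) = 0 :=
    map_zero (ContinuousAlternatingMap.alternatizeUncurryFinCLM ℝ 𝔤 ℂ)
  rw [d, leftDeriv_leftInv, h, zero_add]
  rfl

theorem bracketPart_one_apply (ω : Alt 1) (u v : 𝔤) :
    bracketPart ω ![u, v] = -ω ![⁅u, v⁆] := by
  have := d_one_apply (leftInv ω) 1 u v
  rw [d_leftInv, leftDeriv_leftInv] at this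
  simpa [leftInv] using this

theorem bracketPart_two_apply (ω : Alt 2) (u v w : 𝔤) :
    bracketPart ω ![u, v, w] = -ω ![⁅u, v⁆, w] + ω ![⁅u, w⁆, v] - ω ![⁅v, w⁆, u] := by
  have := d_two_apply (leftInv ω) 1 u v w
  rw [d_leftInv, leftDeriv_leftInv] at this
  simpa [leftInv] using this

theorem removeNth_one_four (a b c e : 𝔤) : Fin.removeNth 1 ![a, b, c, e] = ![a, c, e] := by
  ext i : 1; fin_cases i <;> rfl

theorem removeNth_two_four (a b c e : 𝔤) : Fin.removeNth 2 ![a, b, c, e] = ![a, b, e] := by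
  ext i : 1; fin_cases i <;> rfl

theorem removeNth_three_four (a b c e : 𝔤) : Fin.removeNth 3 ![a, b, c, e] = ![a, b, c] := by
  ext i : 1; fin_cases i <;> rfl

theorem bracketPart_three_apply (ω : Alt 3) (u v w z : 𝔤) :
    bracketPart ω ![u, v, w, z] =
      -ω ![⁅u, v⁆, w, z] + ω ![⁅u, w⁆, v, z] - ω ![⁅u, z⁆, v, w]
        - ω ![⁅v, w⁆, u, z] + ω ![⁅v, z⁆, u, w] - ω ![⁅w, z⁆, u, v] := by
  have h : ∀ a b c e : 𝔤, ω ![⁅b, a⁆, c, e] = -ω ![⁅a, b⁆, c, e] := by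
    intro a b c e
    have hu : ∀ p q : 𝔤, Function.update ![p, c, e] 0 q = ![q, c, e] := by
      intro p q; ext i : 1; fin_cases i <;> rfl
    have := ω.map_update_smul ![⁅a, b⁆, c, e] 0 (-1 : ℝ) ⁅a, b⁆
    rw [hu, hu] at this
    simpa using this
  simp [bracketPart, ContinuousAlternatingMap.alternatizeUncurryFin_apply, Fin.sum_univ_succ,
    removeNth_one_three, removeNth_two_three, removeNth_one_four,
    removeNth_two_four, removeNth_three_four, bracket_apply,
    h u v, h u w, h u z, h v w, h v z, h w z,
    show (Fin.succ 2 : Fin 4) = 3 from rfl]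
  ring

theorem vec_two (m : Fin 2 → 𝔤) : m = ![m 0, m 1] := by
  ext i : 1; fin_cases i <;> rfl

theorem vec_four (m : Fin 4 → 𝔤) : m = ![m 0, m 1, m 2, m 3] := by
  ext i : 1; fin_cases i <;> rfl

theorem alt_two_ext {ω η : Alt 2} (h : ∀ u v, ω ![u, v] = η ![u, v]) : ω = η := by
  ext m; rw [vec_two m]; exact h _ _

theorem comp_vec_two (L : 𝔤 →L[ℝ] 𝔤) (u v : 𝔤) : (L ∘ ![u, v]) = ![L u, L v] := by
  ext i : 1; fin_cases i <;> rfl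

theorem comp_vec_three (L : 𝔤 →L[ℝ] 𝔤) (u v w : 𝔤) : (L ∘ ![u, v, w]) = ![L u, L v, L w] := by
  ext i : 1; fin_cases i <;> rfl

theorem comp_vec_four (L : 𝔤 →L[ℝ] 𝔤) (u v w z : 𝔤) :
    (L ∘ ![u, v, w, z]) = ![L u, L v, L w, L z] := by
  ext i : 1; fin_cases i <;> rfl

theorem dc_leftInv {n : ℕ} (ω : Alt (n + 1)) : dc (leftInv ω) =
    leftInv ((bracketPart (ω.compContinuousLinearMap I)).compContinuousLinearMap (-I)) := by
  have h : pullI (leftInv ω) = leftInv (ω.compContinuousLinearMap I) := rfl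
  rw [dc, h, d_leftInv]
  rfl

theorem del_leftInv {n : ℕ} (ω : Alt (n + 1)) : del (leftInv ω) =
    leftInv ((1 / 2 : ℂ) • (bracketPart ω + Complex.I •
      (bracketPart (ω.compContinuousLinearMap I)).compContinuousLinearMap (-I))) := by
  rw [del, dc_leftInv, d_leftInv]; rfl

theorem delbar_leftInv {n : ℕ} (ω : Alt (n + 1)) : delbar (leftInv ω) =
    leftInv ((1 / 2 : ℂ) • (bracketPart ω - Complex.I •
      (bracketPart (ω.compContinuousLinearMap I)).compContinuousLinearMap (-I))) := by
  rw [delbar, dc_leftInv, d_leftInv]; rfl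

/-! ### The SKT condition as a real equation -/

/-- The left-invariant `3`-form `dF`, where `F(u, v) = g(I u, v)`. -/
def dFund (g : LinearMap.BilinForm ℝ 𝔤) (u v w : 𝔤) : ℝ :=
  -g (I ⁅u, v⁆) w + g (I ⁅u, w⁆) v - g (I ⁅v, w⁆) u

/-- The torsion form `dᶜF` of the Bismut connection. -/
def torsion (g : LinearMap.BilinForm ℝ 𝔤) (u v w : 𝔤) : ℝ :=
  g ⁅I u, I v⁆ w + g ⁅I v, I w⁆ u + g ⁅I w, I u⁆ v

/-- The exterior derivative of a left-invariant real `3`-form. -/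
def extDeriv3 (f : 𝔤 → 𝔤 → 𝔤 → ℝ) (u v w z : 𝔤) : ℝ :=
  -f ⁅u, v⁆ w z + f ⁅u, w⁆ v z - f ⁅u, z⁆ v w - f ⁅v, w⁆ u z + f ⁅v, z⁆ u w - f ⁅w, z⁆ u v

section Hermitian

variable {g : LinearMap.BilinForm ℝ 𝔤} (hg : IsHermitianMetric g)

include hg

theorem metric_I_left (u v : 𝔤) : g (I u) v = -g u (I v) := by
  rw [← hg.herm (I u) v, I_I, map_neg, LinearMap.neg_apply]

theorem fundamentalForm_comp_I :
    (fundamentalForm g).compContinuousLinearMap I = fundamentalForm g := by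
  refine alt_two_ext fun u v => ?_
  rw [ContinuousAlternatingMap.compContinuousLinearMap_apply, comp_vec_two,
    fundamentalForm_apply hg I_I, fundamentalForm_apply hg I_I, hg.herm]

theorem bracketPart_fundamentalForm (u v w : 𝔤) :
    bracketPart (fundamentalForm g) ![u, v, w] = (dFund g u v w : ℂ) := by
  rw [bracketPart_two_apply]
  simp only [fundamentalForm_apply hg I_I, dFund]
  push_cast; ring

theorem dFund_I (u v w : 𝔤) : dFund g (I u) (I v) (I w) = -torsion g u v w := by
  simp only [dFund, torsion, hg.herm]
  rw [← lie_skew (I w) (I u), map_neg, LinearMap.neg_apply]; ring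

theorem torsion_I (u v w : 𝔤) : torsion g (I u) (I v) (I w) = dFund g u v w := by
  simp only [dFund, torsion, I_I, neg_lie, lie_neg, neg_neg, metric_I_left hg]
  rw [← lie_skew w u, map_neg, LinearMap.neg_apply]; ring

omit hg in
theorem dFund_neg (u v w : 𝔤) : dFund g (-u) (-v) (-w) = -dFund g u v w := by
  simp only [dFund, neg_lie, lie_neg, neg_neg, map_neg]; ring

theorem delbar_fundamentalForm_apply (u v w : 𝔤) :
    ((1 / 2 : ℂ) • (bracketPart (fundamentalForm g) - Complex.I •
      (bracketPart ((fundamentalForm g).compContinuousLinearMap I)).compContinuousLinearMap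
        (-I))) ![u, v, w] = 1 / 2 * (dFund g u v w - Complex.I * torsion g u v w) := by
  rw [fundamentalForm_comp_I hg]
  refine (congrArg (fun t => (1 / 2 : ℂ) * (bracketPart (fundamentalForm g) ![u, v, w] -
    Complex.I * bracketPart (fundamentalForm g) t)) (comp_vec_three (-I) u v w)).trans ?_
  simp only [neg_apply, bracketPart_fundamentalForm hg, dFund_neg, dFund_I hg, neg_neg]

/-- This is `d² = 0`: terms `g(I[a,b],[c,e])` cancel by skewness of the fundamental form, and terms
with nested brackets by the Jacobi identity. -/
theorem extDeriv3_dFund (u v w z : 𝔤) : extDeriv3 (dFund g) u v w z = 0 := by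
  have hs : ∀ a b, g (I a) b = -g (I b) a := by
    intro a b; rw [metric_I_left hg, hg.symm]
  have hj : ∀ a b c e, g (I ⁅⁅a, b⁆, c⁆) e = g (I ⁅⁅a, c⁆, b⁆) e - g (I ⁅⁅b, c⁆, a⁆) e := by
    intro a b c e
    have : ⁅⁅a, b⁆, c⁆ = ⁅⁅a, c⁆, b⁆ - ⁅⁅b, c⁆, a⁆ := by
      rw [lie_lie, ← lie_skew a ⁅b, c⁆, ← lie_skew b ⁅a, c⁆]; abel
    rw [this, map_sub, map_sub, LinearMap.sub_apply]
  simp only [extDeriv3, dFund]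
  rw [hs ⁅w, z⁆ ⁅u, v⁆, hs ⁅v, z⁆ ⁅u, w⁆, hs ⁅v, w⁆ ⁅u, z⁆, hj u v w z, hj u v z w,
    hj u w z v, hj v w z u]
  ring

/-- As `F` is `I`-invariant, `∂̄F = ½(dF - iT)` with `T = dᶜF`, and `I` exchanges `dF` and `T` up to
sign. Since `d(dF) = 0`, only `dT` and its pullback by `I` survive. The type of `dT` is not invoked,
so integrability plays no role here. -/
theorem del_delbar_fundamentalForm_apply (x : G) (u v w z : 𝔤) :
    del (delbar (leftInv (fundamentalForm g))) x ![u, v, w, z] =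
      -(Complex.I / 4) * ((extDeriv3 (torsion g) u v w z +
        extDeriv3 (torsion g) (I u) (I v) (I w) (I z) : ℝ) : ℂ) := by
  rw [delbar_leftInv, del_leftInv]
  set η := ((1 / 2 : ℂ) • (bracketPart (fundamentalForm g) - Complex.I •
      (bracketPart ((fundamentalForm g).compContinuousLinearMap I)).compContinuousLinearMap
        (-I))) with hη
  have h1 : ∀ u v w, η ![u, v, w] = 1 / 2 * (dFund g u v w - Complex.I * torsion g u v w) :=
    delbar_fundamentalForm_apply hg
  have h2 : ∀ u v w, (η.compContinuousLinearMap I) ![u, v, w] =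
      1 / 2 * (-torsion g u v w - Complex.I * dFund g u v w) := by
    intro u v w
    rw [ContinuousAlternatingMap.compContinuousLinearMap_apply, comp_vec_three, h1, dFund_I hg,
      torsion_I hg]
    push_cast; ring
  have h3 : ∀ (ζ : Alt 3) (a b c : ℂ),
      (∀ u v w, ζ ![u, v, w] = a * (b * dFund g u v w + c * torsion g u v w)) →
      ∀ u v w z, bracketPart ζ ![u, v, w, z] = a * c * extDeriv3 (torsion g) u v w z := by
    intro ζ a b c h u v w z
    have h0 := congrArg (fun r : ℝ => (r : ℂ)) (extDeriv3_dFund hg u v w z)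
    simp only [extDeriv3] at h0
    push_cast at h0
    rw [bracketPart_three_apply]
    simp only [h, extDeriv3]
    push_cast
    linear_combination a * b * h0
  have h4 := h3 η (1 / 2) 1 (-Complex.I) (by intro u v w; rw [h1]; ring)
  have h5 := h3 (η.compContinuousLinearMap I) (1 / 2) (-Complex.I) (-1)
    (by intro u v w; rw [h2]; ring)
  -- The operator `dᶜ` pulls back by `-I`; in degree four the signs cancel.
  have h6 : extDeriv3 (torsion g) (-I u) (-I v) (-I w) (-I z) =
      extDeriv3 (torsion g) (I u) (I v) (I w) (I z) := by
    have : ∀ a b c, torsion g a (-b) (-c) = torsion g a b c := by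
      intro a b c
      simp only [torsion, neg_lie, lie_neg, neg_neg, map_neg, LinearMap.neg_apply]
    simp only [extDeriv3, neg_lie, lie_neg, neg_neg, this]
  refine (congrArg (fun t => (1 / 2 : ℂ) * (bracketPart η ![u, v, w, z] +
    Complex.I * bracketPart (η.compContinuousLinearMap I) t)) (comp_vec_four (-I) u v w z)).trans ?_
  simp only [neg_apply, h4, h5, h6]
  push_cast; ring

theorem isSKT_iff : IsSKT g ↔ ∀ u v w z, extDeriv3 (torsion g) u v w z +
    extDeriv3 (torsion g) (I u) (I v) (I w) (I z) = 0 := by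
  constructor
  · intro h u v w z
    have h1 := del_delbar_fundamentalForm_apply hg 1 u v w z
    have h2 : del (delbar (leftInv (fundamentalForm g))) = 0 := h
    rw [h2] at h1
    have h3 : (Complex.I / 4) ≠ 0 := by simp
    have h4 := mul_eq_zero.1 h1.symm
    rcases h4 with h4 | h4
    · exact absurd (neg_eq_zero.1 h4) h3
    · exact_mod_cast h4
  · intro h
    change del (delbar (leftInv (fundamentalForm g))) = 0
    funext x
    ext m
    rw [vec_four m, del_delbar_fundamentalForm_apply hg, h]
    simp

end Hermitian

/-! ### Diagonal metrics and the five-parameter family -/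

theorem diagMetric_apply (b : Fin 18 → ℝ) (u v : 𝔤) : diagMetric b u v =
    ∑ k, b k * (coord (eX k) u * coord (eX k) v + coord (eY k) u * coord (eY k) v) := by
  simp [diagMetric, LinearMap.sum_apply, LinearMap.BilinForm.linMulLin_apply, mul_add]

theorem diagMetric_eX (b : Fin 18 → ℝ) (u : 𝔤) (k : Fin 18) :
    diagMetric b u (eX k) = b k * coord (eX k) u := by
  simp [diagMetric_apply, coord_frame]

theorem diagMetric_one (u v : 𝔤) : diagMetric (fun _ => 1) u v = coord u v := by
  rw [diagMetric_apply, coord_self_eq]; simp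

theorem killingMetric_eq : killingMetric = diagMetric fun _ => 1 := by
  ext u v; rw [killingMetric_apply, diagMetric_one]

theorem isHermitianMetric_diagMetric {b : Fin 18 → ℝ} (hb : ∀ k, 0 < b k) :
    IsHermitianMetric (diagMetric b) where
  symm u v := by
    simp only [diagMetric_apply]
    exact Finset.sum_congr rfl fun k _ => by ring
  pos u hu := by
    rw [diagMetric_apply]
    have h0 : ∀ k, 0 ≤ b k * (coord (eX k) u * coord (eX k) u + coord (eY k) u * coord (eY k) u) :=
      fun k => mul_nonneg (hb k).le (add_nonneg (mul_self_nonneg _) (mul_self_nonneg _))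
    refine lt_of_le_of_ne (Finset.sum_nonneg fun k _ => h0 k) fun h => hu ?_
    refine ext_coord fun k => ?_
    have h1 := (Finset.sum_eq_zero_iff_of_nonneg fun k _ => h0 k).1 h.symm k (Finset.mem_univ k)
    have h2 := (mul_eq_zero.1 h1).resolve_left (hb k).ne'
    rw [mul_self_add_mul_self_eq_zero] at h2
    simpa using h2
  herm u v := by
    simp only [diagMetric_apply, coord_I]
    exact Finset.sum_congr rfl fun k _ => by ring

theorem isHermitianMetric_killingMetric : IsHermitianMetric killingMetric := by
  rw [killingMetric_eq]
  exact isHermitianMetric_diagMetric fun _ => one_pos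

theorem fundamentalForm_diagMetric {b : Fin 18 → ℝ} (hb : ∀ k, 0 < b k) :
    fundamentalForm (diagMetric b) =
      ∑ k, (Complex.I / 2 * (b k : ℂ)) • wedge (φ k) (φbar k) := by
  refine alt_two_ext fun u v => ?_
  rw [fundamentalForm_apply (isHermitianMetric_diagMetric hb) I_I, diagMetric_apply,
    ContinuousAlternatingMap.sum_apply]
  push_cast
  refine Finset.sum_congr rfl fun k _ => ?_
  rw [ContinuousAlternatingMap.smul_apply, wedge_apply, φ_apply, φ_apply, φbar_apply, φbar_apply,
    smul_eq_mul, (coord_I k u).1, (coord_I k u).2]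
  push_cast
  linear_combination (b k : ℂ) * ((coord (eX k) u : ℂ) * coord (eY k) v -
    (coord (eX k) v : ℂ) * coord (eY k) u) * Complex.I_sq

/-- The torus coordinates of the linear part of `family p`. -/
def slope (p : Fin 5 → ℝ) : Fin 4 → ℝ :=
  ![p 0 + p 1 - 2 * p 2 + 2 * p 3 - 2 * p 4, p 0 - 2 * p 2 + 3 * p 3 - 2 * p 4,
    p 0 - 2 * p 2 + 2 * p 3 - p 4, p 0 - p 2 + p 3 - p 4]

/-- The structural meaning of the relations: a constant plus a linear functional of the weight, so
that 1 + 4 degrees of freedom account for the five parameters. -/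
theorem family_eq (p : Fin 5 → ℝ) (k : Fin 18) :
    family p k = scale p + ∑ j, slope p j * wt k j := by
  rw [Fin.sum_univ_four]
  fin_cases k <;> simp [family, scale, slope, wt] <;> ring

theorem coord_lie_tor_eq (j : Fin 4) (u v : 𝔤) : coord ⁅tor j, u⁆ v =
    ∑ k, wt k j * (coord (eX k) u * coord (eY k) v - coord (eY k) u * coord (eX k) v) := by
  rw [coord_self_eq]
  exact Finset.sum_congr rfl fun k _ => by simp only [coord_lie_tor]; ring

/-- Splits the fundamental form into a multiple of that of the Killing metric and the forms `coord
⁅tor j, u⁆ v = coord (tor j) ⁅u, v⁆`, which are exact. -/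
theorem diagMetric_family_I (p : Fin 5 → ℝ) (u v : 𝔤) :
    diagMetric (family p) (I u) v =
      scale p * coord (I u) v + ∑ j, slope p j * coord ⁅tor j, u⁆ v := by
  simp only [diagMetric_apply, coord_self_eq (I u), coord_lie_tor_eq, family_eq, coord_I,
    Finset.mul_sum]
  rw [Finset.sum_comm, ← Finset.sum_add_distrib]
  refine Finset.sum_congr rfl fun k _ => ?_
  rw [add_mul, Finset.sum_mul]
  congr 1
  exact Finset.sum_congr rfl fun j _ => by ring

/-! ### The family is SKT -/

theorem lie_jacobi_cyclic (u v w : 𝔤) : ⁅⁅u, v⁆, w⁆ - ⁅⁅u, w⁆, v⁆ + ⁅⁅v, w⁆, u⁆ = 0 := by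
  rw [lie_lie, ← lie_skew v ⁅u, w⁆, ← lie_skew u ⁅v, w⁆]; abel

theorem coord_lie_lie_cyclic (h u v w : 𝔤) :
    -coord ⁅h, ⁅u, v⁆⁆ w + coord ⁅h, ⁅u, w⁆⁆ v - coord ⁅h, ⁅v, w⁆⁆ u = 0 := by
  have := congrArg (coord h) (lie_jacobi_cyclic u v w)
  rw [map_add, map_sub, map_zero] at this
  rw [coord_lie, coord_lie, coord_lie]; linarith

theorem coord_lie_rotate (u v w : 𝔤) : coord ⁅u, v⁆ w = coord ⁅v, w⁆ u := by
  rw [coord_lie, coord_comm]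

/-- Integrability rewrites `[Iu, Iv]`; by invariance of the trace form the extra terms cancel the
other two summands, leaving the Cartan 3-form. -/
theorem torsion_killingMetric (u v w : 𝔤) : torsion killingMetric u v w = coord ⁅u, v⁆ w := by
  simp only [torsion, killingMetric_apply]
  rw [lie_I_I u v, coord_add_left, coord_I_left, coord_add_left, coord_lie_rotate (I w),
    coord_lie_rotate (I v), coord_lie_rotate (I w) u]
  ring

theorem extDeriv3_torsion_killingMetric (u v w z : 𝔤) :
    extDeriv3 (torsion killingMetric) u v w z = 0 := by
  have hQ : ∀ a b c e : 𝔤, coord ⁅⁅a, b⁆, c⁆ e = coord ⁅a, b⁆ ⁅c, e⁆ :=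
    fun a b c e => coord_lie ⁅a, b⁆ c e
  have h := congrArg (fun x => coord x z) (lie_jacobi_cyclic u v w)
  simp only [coord_add_left, coord_sub_left, coord_zero_left, hQ] at h
  simp only [extDeriv3, torsion_killingMetric, hQ]
  rw [coord_comm ⁅u, z⁆, coord_comm ⁅v, z⁆, coord_comm ⁅w, z⁆]
  linear_combination -2 * h

/-- The exact summands of the fundamental form drop out of `dF` by the Jacobi identity, and `dF`
determines the torsion through `dFund_I`. -/
theorem torsion_diagMetric_family {p : Fin 5 → ℝ} (hp : ∀ k, 0 < family p k) (u v w : 𝔤) :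
    torsion (diagMetric (family p)) u v w = scale p * torsion killingMetric u v w := by
  have hd : ∀ u v w, dFund (diagMetric (family p)) u v w = scale p * dFund killingMetric u v w := by
    intro u v w
    have h0 : ∑ j, slope p j * (-coord ⁅tor j, ⁅u, v⁆⁆ w + coord ⁅tor j, ⁅u, w⁆⁆ v
        - coord ⁅tor j, ⁅v, w⁆⁆ u) = 0 :=
      Finset.sum_eq_zero fun j _ => by rw [coord_lie_lie_cyclic, mul_zero]
    simp only [mul_sub, mul_add, mul_neg, Finset.sum_sub_distrib, Finset.sum_add_distrib,
      Finset.sum_neg_distrib] at h0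
    simp only [dFund, diagMetric_family_I, killingMetric_apply]
    linarith
  have h1 := dFund_I (isHermitianMetric_diagMetric hp) u v w
  have h2 := dFund_I isHermitianMetric_killingMetric u v w
  rw [hd] at h1
  linear_combination h1 - scale p * h2

theorem isSKT_killingMetric : IsSKT killingMetric := by
  rw [isSKT_iff isHermitianMetric_killingMetric]
  intro u v w z
  rw [extDeriv3_torsion_killingMetric, extDeriv3_torsion_killingMetric, add_zero]

theorem isSKT_diagMetric_family {p : Fin 5 → ℝ} (hp : ∀ k, 0 < family p k) :
    IsSKT (diagMetric (family p)) := by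
  rw [isSKT_iff (isHermitianMetric_diagMetric hp)]
  have h : ∀ u v w z, extDeriv3 (torsion (diagMetric (family p))) u v w z = 0 := by
    intro u v w z
    have := extDeriv3_torsion_killingMetric u v w z
    simp only [extDeriv3] at this ⊢
    simp only [torsion_diagMetric_family hp]
    linear_combination scale p * this
  intro u v w z
  rw [h, h, add_zero]

/-! ### The torus action -/

theorem exp_neg_mul_exp (u : 𝔤) : exp (-u) * exp u = 1 := by
  apply Subtype.ext
  change NormedSpace.exp (toMat (-u)) * NormedSpace.exp (toMat u) = 1
  rw [map_neg, ← Matrix.exp_add_of_commute _ _ (Commute.neg_left (Commute.refl (toMat u)))]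
  simp

theorem exp_inv (u : 𝔤) : (exp u)⁻¹ = exp (-u) :=
  (eq_inv_of_mul_eq_one_left (exp_neg_mul_exp u)).symm

theorem hasDerivAt_map_conj_exp {𝔸 : Type*} [NormedRing 𝔸] [NormedAlgebra ℝ 𝔸]
    [FiniteDimensional ℝ 𝔸] (L : 𝔸 →ₗ[ℝ] 𝔤) (A U : 𝔸) (s : ℝ) :
    HasDerivAt (fun s : ℝ => L (NormedSpace.exp (s • A) * U * NormedSpace.exp (s • -A)))
      (L (A * (NormedSpace.exp (s • A) * U * NormedSpace.exp (s • -A)) -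
        NormedSpace.exp (s • A) * U * NormedSpace.exp (s • -A) * A)) s := by
  have : CompleteSpace 𝔸 := FiniteDimensional.complete ℝ 𝔸
  have h1 := hasDerivAt_exp_smul_const' A s
  have h2 := hasDerivAt_exp_smul_const (-A) s
  have h3 := (LinearMap.toContinuousLinearMap L).hasFDerivAt.comp_hasDerivAt s
    ((h1.mul_const U).mul h2)
  refine h3.congr_deriv (congrArg L ?_)
  noncomm_ring

theorem hasDerivAt_skew_conj_exp (A U : Matrix (Fin 9) (Fin 9) ℝ) (s : ℝ) :
    HasDerivAt (fun s : ℝ => skew (NormedSpace.exp (s • A) * U * NormedSpace.exp (s • -A)))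
      (skew (A * (NormedSpace.exp (s • A) * U * NormedSpace.exp (s • -A)) -
        NormedSpace.exp (s • A) * U * NormedSpace.exp (s • -A) * A)) s := by
  -- The entrywise norm on matrices is not submultiplicative, so the exponential is differentiated
  -- in the `ℓ^∞` operator norm. Mapping to `𝔤` by `skew` removes the matrix norm from the target,
  -- and unfolding reconciles the instances.
  with_unfolding_all exact (@hasDerivAt_map_conj_exp (Matrix (Fin 9) (Fin 9) ℝ)
    Matrix.linftyOpNormedRing Matrix.linftyOpNormedAlgebra
    (inferInstanceAs (FiniteDimensional ℝ (Matrix (Fin 9) (Fin 9) ℝ))) skew A U s)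

theorem hasDerivAt_Ad_exp (H u : 𝔤) (s : ℝ) :
    HasDerivAt (fun s : ℝ => Ad (exp (s • H)) u) ⁅H, Ad (exp (s • H)) u⁆ s := by
  have h1 : ∀ s : ℝ, toMat (Ad (exp (s • H)) u) =
      NormedSpace.exp (s • toMat H) * toMat u * NormedSpace.exp (s • -toMat H) := by
    intro s
    change NormedSpace.exp (toMat (s • H)) * toMat u * (NormedSpace.exp (toMat (s • H)))ᵀ = _
    rw [← Matrix.exp_transpose, transpose_coe, map_smul, smul_neg]
  have h2 := hasDerivAt_skew_conj_exp (toMat H) (toMat u) s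
  simp only [← h1, ← toMat_lie, skew_toMat] at h2
  exact h2

theorem hasDerivAt_metric_Ad_exp (g : LinearMap.BilinForm ℝ 𝔤) (H u v : 𝔤) (s : ℝ) :
    HasDerivAt (fun s : ℝ => g (Ad (exp (s • H)) u) (Ad (exp (s • H)) v))
      (g ⁅H, Ad (exp (s • H)) u⁆ (Ad (exp (s • H)) v) +
        g (Ad (exp (s • H)) u) ⁅H, Ad (exp (s • H)) v⁆) s := by
  have h := (LinearMap.toContinuousBilinearMap g).hasDerivAt_of_bilinear
    (fun _ => hasDerivAt_Ad_exp H u s) (fun _ => hasDerivAt_Ad_exp H v s)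
  rw [add_comm]
  exact h

theorem Ad_exp_zero (H u : 𝔤) : Ad (exp ((0 : ℝ) • H)) u = u := by
  apply toMat_injective
  change NormedSpace.exp (toMat ((0 : ℝ) • H)) * toMat u *
    (NormedSpace.exp (toMat ((0 : ℝ) • H)))ᵀ = toMat u
  simp

theorem IsRightTorusInvariant.infinitesimal {g : LinearMap.BilinForm ℝ 𝔤}
    (hg : IsRightTorusInvariant g) {H : 𝔤} (hH : H ∈ Submodule.span ℝ (Set.range tor)) (u v : 𝔤) :
    g ⁅H, u⁆ v + g u ⁅H, v⁆ = 0 := by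
  have h1 := hasDerivAt_metric_Ad_exp g H u v 0
  simp only [Ad_exp_zero] at h1
  have h2 : (fun s : ℝ => g (Ad (exp (s • H)) u) (Ad (exp (s • H)) v)) = fun _ => g u v := by
    funext s
    have := hg (exp (-(s • H))) ⟨_, Submodule.neg_mem _ (Submodule.smul_mem _ s hH), rfl⟩ u v
    rwa [exp_inv, neg_neg] at this
  rw [h2] at h1
  exact h1.unique (hasDerivAt_const 0 (g u v))

theorem isRightTorusInvariant_of_infinitesimal {g : LinearMap.BilinForm ℝ 𝔤}
    (hg : ∀ H ∈ Submodule.span ℝ (Set.range tor), ∀ u v, g ⁅H, u⁆ v + g u ⁅H, v⁆ = 0) :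
    IsRightTorusInvariant g := by
  rintro _ ⟨H, hH, rfl⟩ u v
  have hd : ∀ s : ℝ, HasDerivAt (fun s : ℝ => g (Ad (exp (s • -H)) u) (Ad (exp (s • -H)) v)) 0 s := by
    intro s
    have := hasDerivAt_metric_Ad_exp g (-H) u v s
    rwa [hg (-H) (Submodule.neg_mem _ hH)] at this
  have := is_const_of_deriv_eq_zero (fun s => (hd s).differentiableAt) (fun s => (hd s).deriv) 1 0
  simpa only [one_smul, Ad_exp_zero, ← exp_inv] using this

theorem isRightTorusInvariant_diagMetric (b : Fin 18 → ℝ) :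
    IsRightTorusInvariant (diagMetric b) := by
  refine isRightTorusInvariant_of_infinitesimal fun H hH u v => ?_
  induction hH using Submodule.span_induction with
  | mem H hH =>
    obtain ⟨j, rfl⟩ := hH
    rw [diagMetric_apply, diagMetric_apply, ← Finset.sum_add_distrib]
    exact Finset.sum_eq_zero fun k _ => by simp only [coord_lie_tor]; ring
  | zero => simp
  | add x y _ _ hx hy =>
    simp only [add_lie, map_add, LinearMap.add_apply]; linarith
  | smul c x _ hx =>
    simp only [smul_lie, map_smul, LinearMap.smul_apply, smul_eq_mul]
    linear_combination c * hx

theorem genTor_mem : genTor ∈ Submodule.span ℝ (Set.range tor) := by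
  have h : ∀ j, tor j ∈ Submodule.span ℝ (Set.range tor) := fun j =>
    Submodule.subset_span ⟨j, rfl⟩
  exact Submodule.add_mem _ (Submodule.add_mem _ (Submodule.add_mem _ (Submodule.smul_mem _ _ (h 0))
    (Submodule.smul_mem _ _ (h 1))) (Submodule.smul_mem _ _ (h 2))) (h 3)

/-! ### The SKT equation on a pair of root planes -/

section Pairs

variable {g : LinearMap.BilinForm ℝ 𝔤} (hg : IsHermitianMetric g)

omit hg in
-- When two arguments are eigenvectors of `g` relative to `coord`, invariance moves the brackets off
-- `Z`, and `g` itself survives in one term only.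
theorem torsion_of_conformal {A B : 𝔤} {a b : ℝ} (hA : ∀ u, g u A = a * coord u A)
    (hB : ∀ u, g u B = b * coord u B) (Z : 𝔤) : torsion g Z A B =
      b * coord (I Z) ⁅I A, B⁆ + g ⁅I A, I B⁆ Z - a * coord (I Z) ⁅I B, A⁆ := by
  rw [torsion, hA, hB, coord_lie, ← lie_skew (I B), coord_neg_left, coord_lie]; ring

include hg

theorem extDeriv3_torsion_pair {X X' : 𝔤} {a b : ℝ} (hX : ∀ u, g u X = a * coord u X)
    (hIX : ∀ u, g u (I X) = a * coord u (I X)) (hX' : ∀ u, g u X' = b * coord u X')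
    (hIX' : ∀ u, g u (I X') = b * coord u (I X')) :
    extDeriv3 (torsion g) X (I X) X' (I X') = -2 * g ⁅X, I X⁆ ⁅X', I X'⁆
      + g ⁅X, X'⁆ ⁅X, X'⁆ + g ⁅X, I X'⁆ ⁅X, I X'⁆ + g ⁅I X, X'⁆ ⁅I X, X'⁆
      + g ⁅I X, I X'⁆ ⁅I X, I X'⁆
      - 2 * b * (coord (I ⁅X, X'⁆) ⁅X, I X'⁆ + coord (I ⁅I X, X'⁆) ⁅I X, I X'⁆)
      - 2 * a * (coord (I ⁅X, X'⁆) ⁅I X, X'⁆ + coord (I ⁅X, I X'⁆) ⁅I X, I X'⁆) := by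
  have hs : ∀ u v, coord (I u) v = -coord (I v) u := by
    intro u v; rw [coord_I_left, coord_comm]
  rw [extDeriv3, torsion_of_conformal hX' hIX', torsion_of_conformal hIX hIX',
    torsion_of_conformal hIX hX', torsion_of_conformal hX hIX', torsion_of_conformal hX hX',
    torsion_of_conformal hX hIX]
  have hY := I_I X
  have hY' := I_I X'
  generalize I X = Y at *
  generalize I X' = Y' at *
  have e1 : ⁅X', X⁆ = -⁅X, X'⁆ := (lie_skew _ _).symm
  have e2 : ⁅X', Y⁆ = -⁅Y, X'⁆ := (lie_skew _ _).symm
  have e3 : ⁅Y', X⁆ = -⁅X, Y'⁆ := (lie_skew _ _).symm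
  have e4 : ⁅Y', Y⁆ = -⁅Y, Y'⁆ := (lie_skew _ _).symm
  have e5 : ⁅Y, X⁆ = -⁅X, Y⁆ := (lie_skew _ _).symm
  have e6 : ⁅Y', X'⁆ = -⁅X', Y'⁆ := (lie_skew _ _).symm
  simp only [hY, hY', neg_lie, lie_neg, lie_self, e1, e2, e3, e4, e5, e6, map_neg, neg_neg,
    map_zero, LinearMap.neg_apply]
  have h1 := hs ⁅X, X'⁆ ⁅X, Y'⁆
  have h2 := hs ⁅Y, X'⁆ ⁅Y, Y'⁆
  have h3 := hs ⁅X, X'⁆ ⁅Y, X'⁆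
  have h4 := hs ⁅X, Y'⁆ ⁅Y, Y'⁆
  have h5 := hg.symm ⁅X', Y'⁆ ⁅X, Y⁆
  linear_combination b * h1 + b * h2 + a * h3 + a * h4 - h5

end Pairs

/-! ### Brackets of root planes -/

/-- The brackets of the planes spanned by `p` and `q` are those of a root pair whose sum is the
root of `r` and whose difference is not a root. -/
def IsSumPair (c : ℝ) (p q r : 𝔤 × 𝔤) : Prop :=
  ⁅p.1, q.1⁆ = c • r.1 ∧ ⁅p.1, q.2⁆ = c • r.2 ∧ ⁅p.2, q.1⁆ = c • r.2 ∧ ⁅p.2, q.2⁆ = -c • r.1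

theorem sqrt_two_half_sq : (√2 / 2) * (√2 / 2) = (1 / 2 : ℝ) := by
  have := Real.mul_self_sqrt (show (0 : ℝ) ≤ 2 by norm_num); linarith

theorem isSumPair_diff_short {j k : Fin 4} (h : j ≠ k) :
    IsSumPair (-(√2 / 2)) (diffRoot j k) (shortRoot k) (shortRoot j) := by
  simp [IsSumPair, diffRoot, shortRoot, lie_R, fstIx_inj, sndIx_inj, fstIx_ne_sndIx, sndIx_ne_fstIx,
    fstIx_ne_eight, sndIx_ne_eight, h, sub_lie, neg_lie]

theorem isSumPair_diff_diff {j k l : Fin 4} (h : j ≠ k) (h' : k ≠ l) (h'' : j ≠ l) :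
    IsSumPair (-(√2 / 2)) (diffRoot j k) (diffRoot k l) (diffRoot j l) := by
  simp [IsSumPair, diffRoot, lie_R, fstIx_inj, sndIx_inj, fstIx_ne_sndIx, sndIx_ne_fstIx,
    h, h', h'', sub_lie, neg_lie, lie_sub]
  refine ⟨?_, ?_, ?_, ?_⟩ <;> module

theorem isSumPair_diff_sum {j k l : Fin 4} (h : j ≠ k) (h' : k ≠ l) (h'' : j ≠ l) :
    IsSumPair (-(√2 / 2)) (diffRoot j k) (sumRoot k l) (sumRoot j l) := by
  simp [IsSumPair, diffRoot, sumRoot, lie_R, fstIx_inj, sndIx_inj, fstIx_ne_sndIx, sndIx_ne_fstIx,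
    h, h', h'', sub_lie, neg_lie, lie_sub]
  refine ⟨?_, ?_, ?_⟩ <;> module

theorem sumRoot_swap (j k : Fin 4) : sumRoot j k = -sumRoot k j := by
  simp only [sumRoot, R_swap (fstIx j), R_swap (sndIx j)]
  ext1 <;> simp <;> module

/-- The frame lists `f^j + f^k` only for `j < k`; exchanging the indices negates both vectors and so
flips the sign of the constant. -/
theorem isSumPair_diff_sum' {j k l : Fin 4} (h : j ≠ k) (h' : k ≠ l) (h'' : j ≠ l) :
    IsSumPair (√2 / 2) (diffRoot j k) (sumRoot l k) (sumRoot j l) := by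
  have := isSumPair_diff_sum h h' h''
  rw [sumRoot_swap k l] at this
  simpa only [IsSumPair, Prod.fst_neg, Prod.snd_neg, lie_neg, neg_smul, neg_inj, neg_neg,
    neg_eq_iff_eq_neg] using this

theorem lie_sum_sum_disjoint {j k l m : Fin 4} (h1 : j ≠ l) (h2 : j ≠ m) (h3 : k ≠ l)
    (h4 : k ≠ m) : IsSumPair 0 (sumRoot j k) (sumRoot l m) 0 := by
  simp [IsSumPair, sumRoot, lie_R, fstIx_inj, sndIx_inj, fstIx_ne_sndIx, sndIx_ne_fstIx,
    h1, h2, h3, h4, lie_sub, sub_lie]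

theorem lie_sum_diff_disjoint {j k l m : Fin 4} (h1 : j ≠ l) (h2 : j ≠ m) (h3 : k ≠ l)
    (h4 : k ≠ m) : IsSumPair 0 (sumRoot j k) (diffRoot l m) 0 := by
  simp [IsSumPair, sumRoot, diffRoot, lie_R, fstIx_inj, sndIx_inj, fstIx_ne_sndIx, sndIx_ne_fstIx,
    h1, h2, h3, h4, lie_sub, sub_lie]

/-- The sum and difference of these roots are `2f^j` and `2f^k`, which are not roots, so the planes
commute. -/
theorem lie_sum_diff_same {j k : Fin 4} (h : j ≠ k) :
    IsSumPair 0 (sumRoot j k) (diffRoot j k) 0 := by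
  simp [IsSumPair, sumRoot, diffRoot, lie_R, fstIx_inj, sndIx_inj, fstIx_ne_sndIx, sndIx_ne_fstIx,
    h, h.symm, lie_sub, sub_lie, R_swap (sndIx j) (fstIx j), R_swap (sndIx k) (fstIx k)]
  constructor <;> module

/-- Here both the sum and the difference are roots, so the brackets mix two planes and `IsSumPair`
does not apply. -/
theorem lie_short_short {j k : Fin 4} (h : j ≠ k) :
    ⁅(shortRoot j).1, (shortRoot k).1⁆ = (√2 / 2) • ((sumRoot j k).1 + (diffRoot j k).1) ∧
    ⁅(shortRoot j).1, (shortRoot k).2⁆ = (√2 / 2) • ((sumRoot j k).2 - (diffRoot j k).2) ∧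
    ⁅(shortRoot j).2, (shortRoot k).1⁆ = (√2 / 2) • ((sumRoot j k).2 + (diffRoot j k).2) ∧
    ⁅(shortRoot j).2, (shortRoot k).2⁆ = (√2 / 2) • ((diffRoot j k).1 - (sumRoot j k).1) := by
  have hr : ∀ v : 𝔤, (√2 / 2) • (√2 / 2) • v = (1 / 2 : ℝ) • v := fun v => by
    rw [smul_smul, sqrt_two_half_sq]
  simp only [shortRoot, sumRoot, diffRoot, lie_R, fstIx_inj, sndIx_inj, fstIx_ne_sndIx,
    sndIx_ne_fstIx, eight_ne_fstIx, eight_ne_sndIx, fstIx_ne_eight, sndIx_ne_eight, h, if_true,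
    if_false, smul_add, smul_sub, hr]
  refine ⟨?_, ?_, ?_, ?_⟩ <;> module

/-! ### Torus-invariant SKT metrics -/

/-- The bracket commutes with `genTor`, so it lies in the torus; invariance of the trace form reads
off its coordinates as the weight. -/
theorem lie_eX_eY (k : Fin 18) : ⁅eX k, eY k⁆ = ∑ j, wt k j • tor j := by
  have h0 : ⁅genTor, ⁅eX k, eY k⁆⁆ = 0 := by
    rw [leibniz_lie, (lie_genTor_frame k).1, (lie_genTor_frame k).2]; simp
  have h1 : ∀ j, coord (tor j) ⁅eX k, eY k⁆ = wt k j := by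
    intro j
    rw [← coord_lie, (lie_tor_frame j k).1, coord_smul_left, (coord_frame k k).2.2.2]; simp
  have h2 : ∀ m, 2 ≤ m → coord (eX m) ⁅eX k, eY k⁆ = 0 ∧ coord (eY m) ⁅eX k, eY k⁆ = 0 := by
    intro m hm
    have hne : (genWt m : ℝ) ≠ 0 := by exact_mod_cast (genWt_pos m hm).ne'
    have h3 := coord_lie_genTor m ⁅eX k, eY k⁆
    rw [h0, map_zero, map_zero] at h3
    exact ⟨(mul_eq_zero.1 h3.2.symm).resolve_left hne,
      (mul_eq_zero.1 h3.1.symm).resolve_left (neg_ne_zero.2 hne)⟩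
  have hm : ∀ m : Fin 18, 2 ≤ m ∨ m = 0 ∨ m = 1 := by decide
  refine ext_coord fun m => ?_
  rcases hm m with hm | rfl | rfl
  · have h4 : ∀ j, coord (eX m) (tor j) = 0 ∧ coord (eY m) (tor j) = 0 := by
      have ne0 : m ≠ 0 := by rintro rfl; exact absurd hm (by decide)
      have ne1 : m ≠ 1 := by rintro rfl; exact absurd hm (by decide)
      have e0 := coord_frame m 0
      have e1 := coord_frame m 1
      simp only [ne0, ne1, if_false] at e0 e1
      intro j
      fin_cases j
      · exact ⟨e0.1, e0.2.2.1⟩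
      · exact ⟨e0.2.1, e0.2.2.2⟩
      · exact ⟨e1.1, e1.2.2.1⟩
      · exact ⟨e1.2.1, e1.2.2.2⟩
    simp [h2 m hm, h4]
  · change coord (tor 0) _ = coord (tor 0) _ ∧ coord (tor 1) _ = coord (tor 1) _
    simp [h1, coord_tor]
  · change coord (tor 2) _ = coord (tor 2) _ ∧ coord (tor 3) _ = coord (tor 3) _
    simp [h1, coord_tor]

theorem diagMetric_eY (b : Fin 18 → ℝ) (u : 𝔤) (k : Fin 18) :
    diagMetric b u (eY k) = b k * coord (eY k) u := by
  simp [diagMetric_apply, coord_frame]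

section Classification

variable {g : LinearMap.BilinForm ℝ 𝔤} (hg : IsHermitianMetric g) (hT : IsRightTorusInvariant g)

include hg hT

theorem metric_apply_root {k : Fin 18} (hk : 2 ≤ k) (u : 𝔤) :
    g u (eX k) = g (eX k) (eX k) * coord u (eX k) ∧
    g u (eY k) = g (eX k) (eX k) * coord u (eY k) := by
  have hT' := fun u v => hT.infinitesimal genTor_mem u v
  obtain ⟨h1, h2, h3⟩ := conformal_on_root_plane hg.symm hT' hk
  have h4 : ∀ l, l ≠ k → g (eX l) (eX k) = 0 ∧ g (eX l) (eY k) = 0 ∧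
      g (eY l) (eX k) = 0 ∧ g (eY l) (eY k) = 0 := by
    intro l hl
    refine orthogonal_of_genWt_ne hT' fun h => ?_
    rcases genWt_inj l k h with h | ⟨_, h⟩
    · exact hl h
    · exact absurd hk (not_le.2 h)
  rw [coord_comm u, coord_comm u]
  constructor <;> conv_lhs => rw [eq_sum_frame u]
  all_goals
    simp only [map_sum, map_add, map_smul, LinearMap.sum_apply, LinearMap.add_apply,
      LinearMap.smul_apply, smul_eq_mul]
    rw [Finset.sum_eq_single k (fun l _ hl => by simp [h4 l hl]) (by simp)]
  · rw [h2]; ring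
  · rw [h1, h3]; ring

variable (hS : IsSKT g)

include hS

theorem skt_pair_equation {k l : Fin 18} (hk : 2 ≤ k) (hl : 2 ≤ l) :
    -2 * g ⁅eX k, eY k⁆ ⁅eX l, eY l⁆
      + g ⁅eX k, eX l⁆ ⁅eX k, eX l⁆ + g ⁅eX k, eY l⁆ ⁅eX k, eY l⁆ + g ⁅eY k, eX l⁆ ⁅eY k, eX l⁆
      + g ⁅eY k, eY l⁆ ⁅eY k, eY l⁆
      - 2 * g (eX l) (eX l) *
        (coord (I ⁅eX k, eX l⁆) ⁅eX k, eY l⁆ + coord (I ⁅eY k, eX l⁆) ⁅eY k, eY l⁆)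
      - 2 * g (eX k) (eX k) *
        (coord (I ⁅eX k, eX l⁆) ⁅eY k, eX l⁆ + coord (I ⁅eX k, eY l⁆) ⁅eY k, eY l⁆) = 0 := by
  have h := (isSKT_iff hg).1 hS (eX k) (eY k) (eX l) (eY l)
  have hk' := metric_apply_root hg hT hk
  have hl' := metric_apply_root hg hT hl
  have h1 := extDeriv3_torsion_pair hg (X := eX k) (X' := eX l) (fun u => (hk' u).1)
    (fun u => by rw [I_eX]; exact (hk' u).2) (fun u => (hl' u).1)
    (fun u => by rw [I_eX]; exact (hl' u).2)
  -- `I` sends the quadruple to one of the same shape, starting from `eY k` and `eY l`. The same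
  -- formula applies and gives an equal value.
  have h2 := extDeriv3_torsion_pair hg (X := eY k) (X' := eY l) (fun u => (hk' u).2)
    (fun u => by rw [I_eY, map_neg, map_neg, (hk' u).1, mul_neg]) (fun u => (hl' u).2)
    (fun u => by rw [I_eY, map_neg, map_neg, (hl' u).1, mul_neg])
  have hs : ∀ u v, coord (I u) v = -coord (I v) u := by
    intro u v; rw [coord_I_left, coord_comm]
  simp only [I_eX, I_eY] at h1 h2 h
  rw [h1, h2] at h
  have e1 : ⁅eY k, eX k⁆ = -⁅eX k, eY k⁆ := (lie_skew _ _).symm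
  have e2 : ⁅eY l, eX l⁆ = -⁅eX l, eY l⁆ := (lie_skew _ _).symm
  simp only [neg_lie, lie_neg, e1, e2, map_neg, neg_neg, LinearMap.neg_apply, coord_neg_left] at h
  have h3 := hs ⁅eX k, eX l⁆ ⁅eX k, eY l⁆
  have h4 := hs ⁅eY k, eX l⁆ ⁅eY k, eY l⁆
  have h5 := hs ⁅eX k, eX l⁆ ⁅eY k, eX l⁆
  have h6 := hs ⁅eX k, eY l⁆ ⁅eY k, eY l⁆
  linear_combination h / 2 - g (eX l) (eX l) * (h3 + h4) - g (eX k) (eX k) * (h5 + h6)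

/-- With `c² = 1/2`, the four squared brackets contribute `2 b_m`, and the mixed terms `-2 b_l` and
`-2 b_k`. -/
theorem skt_sum_equation {k l m : Fin 18} (hk : 2 ≤ k) (hl : 2 ≤ l) (hm : 2 ≤ m) {c : ℝ}
    (hc : c * c = 1 / 2) (h : IsSumPair c (frame k) (frame l) (frame m)) :
    g ⁅eX k, eY k⁆ ⁅eX l, eY l⁆ = g (eX m) (eX m) - g (eX k) (eX k) - g (eX l) (eX l) := by
  have e := skt_pair_equation hg hT hS hk hl
  have hm' := fun u => metric_apply_root hg hT hm u
  have hf := coord_frame m m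
  obtain ⟨h1, h2, h3, h4⟩ := h
  have hY : g (eY m) (eY m) = g (eX m) (eX m) := by rw [(hm' _).2, hf.2.2.2]; simp
  rw [h1, h2, h3, h4] at e
  simp only [map_smul, map_neg, LinearMap.smul_apply, smul_eq_mul, I_eX, I_eY, hY, coord_smul_left,
    coord_neg_left, hf, if_true, neg_smul, LinearMap.neg_apply] at e
  linear_combination (-1 / 2 : ℝ) * e +
    2 * (g (eX m) (eX m) - g (eX k) (eX k) - g (eX l) (eX l)) * hc

theorem skt_orthogonal_equation {k l : Fin 18} (hk : 2 ≤ k) (hl : 2 ≤ l)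
    (h : IsSumPair 0 (frame k) (frame l) 0) : g ⁅eX k, eY k⁆ ⁅eX l, eY l⁆ = 0 := by
  have e := skt_pair_equation hg hT hS hk hl
  obtain ⟨h1, h2, h3, h4⟩ := h
  rw [h1, h2, h3, h4] at e
  simpa using e

theorem metric_tor : ∀ i j, g (tor i) (tor j) = if i = j then g (tor 0) (tor 0) else 0 := by
  have hI : ∀ i j, g (I (tor i)) (I (tor j)) = g (tor i) (tor j) := fun i j => hg.herm _ _
  have I0 : I (tor 0) = tor 1 := I_eX 0
  have I1 : I (tor 1) = -tor 0 := I_eY 0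
  have I2 : I (tor 2) = tor 3 := I_eX 1
  have I3 : I (tor 3) = -tor 2 := I_eY 1
  have h00 := hI 0 0
  have h01 := hI 0 1
  have h22 := hI 2 2
  have h23 := hI 2 3
  have h02 := hI 0 2
  have h03 := hI 0 3
  simp only [I0, I1, I2, I3, map_neg] at h00 h01 h22 h23 h02 h03
  have s := fun i j => hg.symm (tor i) (tor j)
  -- The isometry `I` makes `g` conformal on each of the two torus planes and leaves two unknown
  -- entries between them. The pairs `f¹+f², f³±f⁴` kill these, and `f¹+f³, f¹-f³` equates the two
  -- scales.
  have e1 := skt_orthogonal_equation hg hT hS (k := 6) (l := 11) (by decide) (by decide)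
    (lie_sum_sum_disjoint (by decide) (by decide) (by decide) (by decide))
  have e2 := skt_orthogonal_equation hg hT hS (k := 6) (l := 17) (by decide) (by decide)
    (lie_sum_diff_disjoint (by decide) (by decide) (by decide) (by decide))
  have e3 := skt_orthogonal_equation hg hT hS (k := 7) (l := 13) (by decide) (by decide)
    (lie_sum_diff_same (by decide))
  simp only [lie_eX_eY, Fin.sum_univ_four] at e1 e2 e3
  simp [wt] at e1 e2 e3
  rw [s 1 0] at h01
  rw [s 3 2] at h23
  rw [s 2 0] at e3
  intro i j
  fin_cases i <;> fin_cases j <;> simp <;>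
    linarith [s 1 0, s 2 0, s 3 0, s 2 1, s 3 1, s 3 2]

theorem metric_lie_eX_eY (k l : Fin 18) :
    g ⁅eX k, eY k⁆ ⁅eX l, eY l⁆ = g (tor 0) (tor 0) * ∑ j, wt k j * wt l j := by
  have h := metric_tor hg hT hS
  generalize g (tor 0) (tor 0) = s at h ⊢
  simp only [lie_eX_eY, map_sum, map_smul, LinearMap.sum_apply, LinearMap.smul_apply, smul_eq_mul,
    h, mul_ite, mul_zero, Finset.sum_ite_eq', Finset.mem_univ, if_true,
    Finset.mul_sum]
  exact Finset.sum_congr rfl fun j _ => by ring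

/-- Torus invariance settles everything involving a root plane but says nothing inside the torus,
where SKT enters through `metric_tor`. -/
theorem eq_diagMetric : g = diagMetric fun k => g (eX k) (eX k) := by
  have hb : ∀ k, 0 < g (eX k) (eX k) := fun k => hg.pos _ fun h => by
    have := coord_eX_self k
    rw [h, map_zero] at this
    exact zero_ne_one this
  have hroot : ∀ u l, 2 ≤ l →
      g u (eX l) = diagMetric (fun k => g (eX k) (eX k)) u (eX l) ∧
      g u (eY l) = diagMetric (fun k => g (eX k) (eX k)) u (eY l) := by
    intro u l hl
    rw [diagMetric_eX, diagMetric_eY, ← coord_comm u, ← coord_comm u]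
    exact metric_apply_root hg hT hl u
  have htor : ∀ i j, g (tor i) (tor j) =
      diagMetric (fun k => g (eX k) (eX k)) (tor i) (tor j) := by
    have h2 : g (tor 2) (tor 2) = g (tor 0) (tor 0) := metric_tor hg hT hS 2 2
    intro i j
    rw [metric_tor hg hT hS]
    fin_cases j
    · refine .trans ?_ (diagMetric_eX _ _ 0).symm
      simp [eX, frame, coord_tor, eq_comm]
    · refine .trans ?_ (diagMetric_eY _ _ 0).symm
      simp [eX, eY, frame, coord_tor, eq_comm]
    · refine .trans ?_ (diagMetric_eX _ _ 1).symm
      simp [eX, frame, coord_tor, eq_comm, h2]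
    · refine .trans ?_ (diagMetric_eY _ _ 1).symm
      simp [eX, eY, frame, coord_tor, eq_comm, h2]
  have hD := (isHermitianMetric_diagMetric hb).symm
  have hm : ∀ m : Fin 18, 2 ≤ m ∨ m = 0 ∨ m = 1 := by decide
  refine LinearMap.ext₂ fun u v => ext_bilin_frame ?_ ?_ ?_ ?_ u v
  all_goals
    intro k l
    rcases hm l with hl | hl
    · first | exact (hroot _ l hl).1 | exact (hroot _ l hl).2
    rcases hm k with hk | hk
    · rw [hg.symm, hD]
      first | exact (hroot _ k hk).1 | exact (hroot _ k hk).2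
    rcases hk with rfl | rfl <;> rcases hl with rfl | rfl <;> exact htor _ _

theorem eq_family : (fun k => g (eX k) (eX k)) = family ![g (eX 5) (eX 5), g (eX 14) (eX 14),
    g (eX 15) (eX 15), g (eX 16) (eX 16), g (eX 17) (eX 17)] := by
  have hn : -(√2 / 2) * -(√2 / 2) = (1 / 2 : ℝ) := by rw [neg_mul_neg, sqrt_two_half_sq]
  have key : ∀ {c : ℝ}, c * c = 1 / 2 → ∀ k l m : Fin 18, 2 ≤ k → 2 ≤ l → 2 ≤ m →
      IsSumPair c (frame k) (frame l) (frame m) →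
      g (tor 0) (tor 0) * (wt k 0 * wt l 0 + wt k 1 * wt l 1 + wt k 2 * wt l 2 + wt k 3 * wt l 3) =
        g (eX m) (eX m) - g (eX k) (eX k) - g (eX l) (eX l) := by
    intro c hc k l m hk hl hm h
    rw [← skt_sum_equation hg hT hS hk hl hm hc h, metric_lie_eX_eY hg hT hS, Fin.sum_univ_four]
  -- Each relation expresses a root as a sum of two others, starting from `f³ = (f³-f⁴) + f⁴`. The
  -- one for `f²-f⁴` also fixes the torus scale, as its two summands have inner product -1.
  have e4 := key hn 17 5 4 (by decide) (by decide) (by decide) (isSumPair_diff_short (by decide))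
  have e3 := key hn 15 4 3 (by decide) (by decide) (by decide) (isSumPair_diff_short (by decide))
  have e2 := key hn 12 3 2 (by decide) (by decide) (by decide) (isSumPair_diff_short (by decide))
  have e16 := key hn 15 17 16 (by decide) (by decide) (by decide)
    (isSumPair_diff_diff (by decide) (by decide) (by decide))
  have e13 := key hn 12 15 13 (by decide) (by decide) (by decide)
    (isSumPair_diff_diff (by decide) (by decide) (by decide))
  have e14 := key hn 12 16 14 (by decide) (by decide) (by decide)
    (isSumPair_diff_diff (by decide) (by decide) (by decide))
  have e10 := key hn 15 11 10 (by decide) (by decide) (by decide)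
    (isSumPair_diff_sum (by decide) (by decide) (by decide))
  have e8 := key hn 12 10 8 (by decide) (by decide) (by decide)
    (isSumPair_diff_sum (by decide) (by decide) (by decide))
  have e7 := key hn 12 9 7 (by decide) (by decide) (by decide)
    (isSumPair_diff_sum (by decide) (by decide) (by decide))
  have e9 := key sqrt_two_half_sq 16 11 9 (by decide) (by decide) (by decide)
    (isSumPair_diff_sum' (by decide) (by decide) (by decide))
  have e6 := key sqrt_two_half_sq 13 9 6 (by decide) (by decide) (by decide)
    (isSumPair_diff_sum' (by decide) (by decide) (by decide))
  -- `f³ + f⁴` is the first sum root to be reached, and it comes from the orthogonal short roots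
  -- `f³, f⁴`. The coefficient of `f⁴` cancels because the contributions of `f³ + f⁴` and `f³ - f⁴`
  -- to it have opposite signs.
  have e11 : g (eX 11) (eX 11) + g (eX 17) (eX 17) = 2 * g (eX 4) (eX 4) := by
    have e := skt_pair_equation hg hT hS (k := 4) (l := 5) (by decide) (by decide)
    have hb := lie_short_short (j := 2) (k := 3) (by decide)
    change ⁅eX 4, eX 5⁆ = (√2 / 2) • (eX 11 + eX 17) ∧
      ⁅eX 4, eY 5⁆ = (√2 / 2) • (eY 11 - eY 17) ∧ ⁅eY 4, eX 5⁆ = (√2 / 2) • (eY 11 + eY 17) ∧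
      ⁅eY 4, eY 5⁆ = (√2 / 2) • (eX 17 - eX 11) at hb
    have h11 := fun u => metric_apply_root hg hT (k := 11) (by decide) u
    have h17 := fun u => metric_apply_root hg hT (k := 17) (by decide) u
    have hw : ∑ j, wt 4 j * wt 5 j = 0 := by simp [Fin.sum_univ_four, wt]
    rw [metric_lie_eX_eY hg hT hS, hw, hb.1, hb.2.1, hb.2.2.1, hb.2.2.2] at e
    have n : (11 : Fin 18) ≠ 17 := by decide
    have q1 : g (eX 17) (eX 11) = 0 := by rw [(h11 _).1]; simp [coord_frame, n.symm]
    have q2 : g (eX 11) (eX 17) = 0 := by rw [(h17 _).1]; simp [coord_frame, n]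
    have q3 : g (eY 17) (eY 11) = 0 := by rw [(h11 _).2]; simp [coord_frame, n.symm]
    have q4 : g (eY 11) (eY 17) = 0 := by rw [(h17 _).2]; simp [coord_frame, n]
    have q5 : g (eY 11) (eY 11) = g (eX 11) (eX 11) := by rw [(h11 _).2]; simp [coord_frame]
    have q6 : g (eY 17) (eY 17) = g (eX 17) (eX 17) := by rw [(h17 _).2]; simp [coord_frame]
    simp only [map_smul, map_add, map_sub, LinearMap.smul_apply, LinearMap.add_apply,
      LinearMap.sub_apply, smul_eq_mul, I_eX, I_eY, coord_smul_left, coord_add_left, coord_sub_left,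
      coord_neg_left, coord_frame, if_true, n, n.symm, if_false, q1, q2, q3, q4, q5, q6] at e
    linear_combination e / 2 -
      2 * (g (eX 11) (eX 11) + g (eX 17) (eX 17) - 2 * g (eX 4) (eX 4)) * hn
  have e0 : g (eX 0) (eX 0) = g (tor 0) (tor 0) := rfl
  have e1 : g (eX 1) (eX 1) = g (tor 0) (tor 0) := metric_tor hg hT hS 2 2
  simp [wt] at e2 e3 e4 e6 e7 e8 e9 e10 e13 e14 e16
  funext k
  fin_cases k <;> simp [family] <;> linarith

end Classification

/-! ### Comparison with the Killing metric -/

theorem bracketPart_oneForm_apply (α : 𝔤 →L[ℝ] ℂ) (u v : 𝔤) :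
    bracketPart (oneForm α) ![u, v] = -α ⁅u, v⁆ := by
  rw [bracketPart_one_apply]; simp [oneForm]

theorem φ_zero_lie (u v : 𝔤) :
    φ 0 ⁅u, v⁆ = (coord ⁅tor 0, u⁆ v : ℂ) + Complex.I * (coord ⁅tor 1, u⁆ v : ℂ) := by
  rw [φ_apply, coord_lie, coord_lie]; rfl

theorem φ_one_lie (u v : 𝔤) :
    φ 1 ⁅u, v⁆ = (coord ⁅tor 2, u⁆ v : ℂ) + Complex.I * (coord ⁅tor 3, u⁆ v : ℂ) := by
  rw [φ_apply, coord_lie, coord_lie]; rfl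

theorem φbar_zero_lie (u v : 𝔤) :
    φbar 0 ⁅u, v⁆ = (coord ⁅tor 0, u⁆ v : ℂ) - Complex.I * (coord ⁅tor 1, u⁆ v : ℂ) := by
  rw [φbar_apply, coord_lie, coord_lie]; rfl

theorem φbar_one_lie (u v : 𝔤) :
    φbar 1 ⁅u, v⁆ = (coord ⁅tor 2, u⁆ v : ℂ) - Complex.I * (coord ⁅tor 3, u⁆ v : ℂ) := by
  rw [φbar_apply, coord_lie, coord_lie]; rfl

/-- The real and imaginary parts of `φ₁, φ₂` are the four torus coordinates, whose differentials are
the forms `-coord ⁅tor j, u⁆ v` of `diagMetric_family_I`. -/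
theorem fundamentalForm_family {p : Fin 5 → ℝ} (hp : ∀ k, 0 < family p k) :
    leftInv (fundamentalForm (diagMetric (family p))) =
        (scale p : ℂ) • leftInv (fundamentalForm killingMetric)
          - ((1 / 2 * (p 0 + p 1 - 2 * p 2 + 2 * p 3 - 2 * p 4) : ℝ) : ℂ) •
              d (leftInv (oneForm (φ 0 + φbar 0)))
          - (Complex.I / 2 * ((p 0 - 2 * p 2 + 3 * p 3 - 2 * p 4 : ℝ) : ℂ)) •
              d (leftInv (oneForm (φbar 0 - φ 0)))
          - ((1 / 2 * (p 0 - 2 * p 2 + 2 * p 3 - p 4) : ℝ) : ℂ) •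
              d (leftInv (oneForm (φ 1 + φbar 1)))
          - (Complex.I / 2 * ((p 0 - p 2 + p 3 - p 4 : ℝ) : ℂ)) •
              d (leftInv (oneForm (φbar 1 - φ 1))) := by
  simp only [d_leftInv]
  funext x
  refine alt_two_ext fun u v => ?_
  simp only [Pi.sub_apply, Pi.smul_apply, leftInv, ContinuousAlternatingMap.sub_apply,
    ContinuousAlternatingMap.smul_apply, smul_eq_mul]
  rw [fundamentalForm_apply (isHermitianMetric_diagMetric hp) I_I,
    fundamentalForm_apply isHermitianMetric_killingMetric I_I, diagMetric_family_I,
    killingMetric_apply, bracketPart_oneForm_apply, bracketPart_oneForm_apply,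
    bracketPart_oneForm_apply, bracketPart_oneForm_apply, Fin.sum_univ_four]
  simp only [add_apply, sub_apply, φ_zero_lie, φ_one_lie, φbar_zero_lie, φbar_one_lie, slope,
    Matrix.cons_val]
  push_cast
  linear_combination ((p 0 - 2 * p 2 + 3 * p 3 - 2 * p 4 : ℂ) * coord ⁅tor 1, u⁆ v +
    (p 0 - p 2 + p 3 - p 4 : ℂ) * coord ⁅tor 3, u⁆ v) * Complex.I_sq

theorem fundamentalForm_family_eq_iff {p : Fin 5 → ℝ} (hp : ∀ k, 0 < family p k) :
    fundamentalForm (diagMetric (family p)) = fundamentalForm killingMetric ↔ p = fun _ => 1 := by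
  constructor
  · intro h
    have hf : ∀ k, family p k = 1 := by
      intro k
      have h1 := congrArg (fun ω : Alt 2 => ω ![eX k, eY k]) h
      beta_reduce at h1
      rw [fundamentalForm_apply (isHermitianMetric_diagMetric hp) I_I,
        fundamentalForm_apply isHermitianMetric_killingMetric I_I, I_eX, diagMetric_eY,
        killingMetric_apply, (coord_frame k k).2.2.2, if_pos rfl, mul_one] at h1
      exact_mod_cast h1
    funext i
    fin_cases i
    · exact hf 5
    · exact hf 14
    · exact hf 15
    · exact hf 16
    · exact hf 17
  · rintro rfl
    have : family (fun _ => 1) = fun _ => 1 := by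
      funext k; fin_cases k <;> simp [family] <;> norm_num
    rw [this, killingMetric_eq]

/-! ### Aeppli classes -/

theorem isSmooth_leftInv {n : ℕ} (ω : Alt n) : IsSmooth (leftInv ω) := fun _ => contDiff_const

theorem φ_I (k : Fin 18) (u : 𝔤) : φ k (I u) = Complex.I * φ k u := by
  rw [φ_apply, φ_apply, (coord_I k u).1, (coord_I k u).2]
  push_cast
  linear_combination (-(coord (eY k) u : ℂ)) * Complex.I_sq

theorem φbar_I (k : Fin 18) (u : 𝔤) : φbar k (I u) = -Complex.I * φbar k u := by
  rw [φbar_apply, φbar_apply, (coord_I k u).1, (coord_I k u).2]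
  push_cast
  linear_combination (-(coord (eY k) u : ℂ)) * Complex.I_sq

/-- `I` commutes with the torus action and is an isometry of `coord`; this is why the differentials
of the torus coordinates have type (1,1). -/
theorem coord_lie_tor_I_I (j : Fin 4) (u v : 𝔤) : coord ⁅tor j, I u⁆ (I v) = coord ⁅tor j, u⁆ v := by
  rw [lie_tor_I, coord_I_I]

/-- An exact left-invariant form of type `(1,1)` with primitive of type `(1,0)` is `∂̄`-exact. -/
theorem d_eq_delbar {α : 𝔤 →L[ℝ] ℂ} (hα : ∀ u, α (I u) = Complex.I * α u)
    (h11 : ∀ u v, α ⁅I u, I v⁆ = α ⁅u, v⁆) :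
    d (leftInv (oneForm α)) = delbar (leftInv (oneForm α)) := by
  rw [delbar_leftInv, d_leftInv]
  congr 1
  refine alt_two_ext fun u v => ?_
  have h1 : (oneForm α).compContinuousLinearMap I = Complex.I • oneForm α := by
    ext m; simp [oneForm, hα]
  rw [h1]
  refine .trans ?_ (congrArg (fun t => (1 / 2 : ℂ) * (bracketPart (oneForm α) ![u, v] -
    Complex.I * bracketPart (Complex.I • oneForm α) t)) (comp_vec_two (-I) u v)).symm
  rw [bracketPart_one_apply, bracketPart_one_apply]
  simp [oneForm, h11]
  linear_combination (-1 / 2 : ℂ) * α ⁅u, v⁆ * Complex.I_sq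

theorem d_eq_del {α : 𝔤 →L[ℝ] ℂ} (hα : ∀ u, α (I u) = -Complex.I * α u)
    (h11 : ∀ u v, α ⁅I u, I v⁆ = α ⁅u, v⁆) :
    d (leftInv (oneForm α)) = del (leftInv (oneForm α)) := by
  rw [del_leftInv, d_leftInv]
  congr 1
  refine alt_two_ext fun u v => ?_
  have h1 : (oneForm α).compContinuousLinearMap I = -Complex.I • oneForm α := by
    ext m; simp [oneForm, hα]
  rw [h1]
  refine .trans ?_ (congrArg (fun t => (1 / 2 : ℂ) * (bracketPart (oneForm α) ![u, v] +
    Complex.I * bracketPart (-Complex.I • oneForm α) t)) (comp_vec_two (-I) u v)).symm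
  rw [bracketPart_one_apply, bracketPart_one_apply]
  simp [oneForm, h11]
  linear_combination (-1 / 2 : ℂ) * α ⁅u, v⁆ * Complex.I_sq

theorem d_φ_mem_aeppliExact {k : Fin 18} (h11 : ∀ u v, φ k ⁅I u, I v⁆ = φ k ⁅u, v⁆) :
    d (leftInv (oneForm (φ k))) ∈ aeppliExact :=
  Submodule.subset_span (Or.inr ⟨_, isSmooth_leftInv _, fun x u => by
    simp [leftInv, oneForm, φ_I], d_eq_delbar (φ_I k) h11⟩)

theorem d_φbar_mem_aeppliExact {k : Fin 18} (h11 : ∀ u v, φbar k ⁅I u, I v⁆ = φbar k ⁅u, v⁆) :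
    d (leftInv (oneForm (φbar k))) ∈ aeppliExact :=
  Submodule.subset_span (Or.inl ⟨_, isSmooth_leftInv _, fun x u => by
    simp [leftInv, oneForm, φbar_I], d_eq_del (φbar_I k) h11⟩)

theorem d_oneForm_add (α β : 𝔤 →L[ℝ] ℂ) : d (leftInv (oneForm (α + β))) =
    d (leftInv (oneForm α)) + d (leftInv (oneForm β)) := by
  simp only [d_leftInv]
  funext x
  refine alt_two_ext fun u v => ?_
  simp only [Pi.add_apply, leftInv, ContinuousAlternatingMap.add_apply, bracketPart_oneForm_apply,
    add_apply]
  ring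

theorem d_oneForm_sub (α β : 𝔤 →L[ℝ] ℂ) : d (leftInv (oneForm (α - β))) =
    d (leftInv (oneForm α)) - d (leftInv (oneForm β)) := by
  simp only [d_leftInv]
  funext x
  refine alt_two_ext fun u v => ?_
  simp only [Pi.sub_apply, leftInv, ContinuousAlternatingMap.sub_apply, bracketPart_oneForm_apply,
    sub_apply]
  ring

theorem aeppliClass_family {p : Fin 5 → ℝ} (hp : ∀ k, 0 < family p k) :
    aeppliClass (leftInv (fundamentalForm (diagMetric (family p)))) =
        (scale p : ℂ) • aeppliClass (leftInv (fundamentalForm killingMetric)) := by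
  rw [aeppliClass, aeppliClass, ← Submodule.Quotient.mk_smul, Submodule.Quotient.eq,
    fundamentalForm_family hp, d_oneForm_add, d_oneForm_add, d_oneForm_sub, d_oneForm_sub]
  have m1 : d (leftInv (oneForm (φ 0))) ∈ aeppliExact := d_φ_mem_aeppliExact fun u v => by
    simp only [φ_zero_lie, coord_lie_tor_I_I]
  have m2 : d (leftInv (oneForm (φ 1))) ∈ aeppliExact := d_φ_mem_aeppliExact fun u v => by
    simp only [φ_one_lie, coord_lie_tor_I_I]
  have m3 : d (leftInv (oneForm (φbar 0))) ∈ aeppliExact := d_φbar_mem_aeppliExact fun u v => by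
    simp only [φbar_zero_lie, coord_lie_tor_I_I]
  have m4 : d (leftInv (oneForm (φbar 1))) ∈ aeppliExact := d_φbar_mem_aeppliExact fun u v => by
    simp only [φbar_one_lie, coord_lie_tor_I_I]
  have ha : ∀ {a b} (c : ℂ), a ∈ aeppliExact → b ∈ aeppliExact → c • (a + b) ∈ aeppliExact :=
    fun c h h' => Submodule.smul_mem _ c (Submodule.add_mem _ h h')
  have hs : ∀ {a b} (c : ℂ), a ∈ aeppliExact → b ∈ aeppliExact → c • (a - b) ∈ aeppliExact :=
    fun c h h' => Submodule.smul_mem _ c (Submodule.sub_mem _ h h')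
  have h : ∀ x a b c e : Form 2, x - a - b - c - e - x = -(a + (b + (c + e))) := by
    intro x a b c e; abel
  rw [h]
  exact Submodule.neg_mem _ (Submodule.add_mem _ (ha _ m1 m3) (Submodule.add_mem _ (hs _ m3 m1)
    (Submodule.add_mem _ (ha _ m2 m4) (hs _ m4 m2))))

/-! ### The parameter space -/

theorem isOpen_family_pos : IsOpen {p : Fin 5 → ℝ | ∀ k, 0 < family p k} := by
  rw [Set.ofPred_forall]
  refine isOpen_iInter_of_finite fun k => isOpen_lt continuous_const ?_
  simp only [family_eq, Fin.sum_univ_four, scale, slope, Matrix.cons_val]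
  fun_prop

theorem family_pos_nonempty : {p : Fin 5 → ℝ | ∀ k, 0 < family p k}.Nonempty :=
  ⟨fun _ => 1, fun k => by fin_cases k <;> simp [family] <;> norm_num⟩

theorem diagMetric_injective : Function.Injective diagMetric := by
  intro b c h
  funext k
  have h1 : diagMetric b (eX k) (eX k) = diagMetric c (eX k) (eX k) := by rw [h]
  simpa [diagMetric_eX, coord_eX_self] using h1

theorem family_injective : Function.Injective family := by
  intro p q h
  funext i
  fin_cases i
  · exact congrFun h 5
  · exact congrFun h 14
  · exact congrFun h 15
  · exact congrFun h 16
  · exact congrFun h 17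

/-! ### The SKT criteria -/

theorem isSKT_diagMetric_iff {b : Fin 18 → ℝ} (hb : ∀ k, 0 < b k) :
    IsSKT (diagMetric b) ↔ b = family ![b 5, b 14, b 15, b 16, b 17] := by
  constructor
  · intro h
    have := eq_family (isHermitianMetric_diagMetric hb) (isRightTorusInvariant_diagMetric b) h
    simpa only [diagMetric_eX, coord_eX_self, mul_one] using this
  · intro h
    rw [h] at hb ⊢
    exact isSKT_diagMetric_family hb

theorem isSKT_iff_mem_family {g : LinearMap.BilinForm ℝ 𝔤} (hg : IsHermitianMetric g)
    (hT : IsRightTorusInvariant g) :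
    IsSKT g ↔ ∃ p : Fin 5 → ℝ, (∀ k, 0 < family p k) ∧ g = diagMetric (family p) := by
  constructor
  · intro h
    have h1 := eq_family hg hT h
    refine ⟨_, fun k => ?_, (eq_diagMetric hg hT h).trans (congrArg diagMetric h1)⟩
    rw [← h1]
    exact hg.pos _ fun h0 => zero_ne_one (by rw [← coord_eX_self k, h0, map_zero])
  · rintro ⟨p, hp, rfl⟩
    exact isSKT_diagMetric_family hp

end SO9

end

theorem mainTheorem7 :
    -- `I` is an integrable complex structure of Samelson type, and `φ` is the coframe dual to the frame
    ((∀ u, I (I u) = -u) ∧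
      (∀ u v, ⁅I u, I v⁆ - I ⁅I u, v⁆ - I ⁅u, I v⁆ - ⁅u, v⁆ = 0) ∧
      I (tor 0) = tor 1 ∧ I (tor 2) = tor 3 ∧
      (∀ k, I (frame k).1 = (frame k).2) ∧
      (∀ (k : Fin 16) (j : Fin 4),
        ⁅tor j, (frame (Fin.natAdd 2 k)).1⁆ = posRoot k j • (frame (Fin.natAdd 2 k)).2 ∧
        ⁅tor j, (frame (Fin.natAdd 2 k)).2⁆ = -posRoot k j • (frame (Fin.natAdd 2 k)).1) ∧
      (∀ k l, φ k (frame l).1 = (if k = l then 1 else 0) ∧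
        φ k (frame l).2 = (if k = l then Complex.I else 0))) ∧
    -- the diagonal metrics, and which of them are SKT
    (∀ b : Fin 18 → ℝ, (∀ k, 0 < b k) →
      IsHermitianMetric (diagMetric b) ∧ IsRightTorusInvariant (diagMetric b) ∧
      fundamentalForm (diagMetric b) =
        ∑ k, (Complex.I / 2 * (b k : ℂ)) • wedge (φ k) (φbar k) ∧
      (IsSKT (diagMetric b) ↔ b = family ![b 5, b 14, b 15, b 16, b 17])) ∧
    -- the admissible parameters form a nonempty open set, and they parametrise injectively
    (IsOpen {p : Fin 5 → ℝ | ∀ k, 0 < family p k} ∧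
      {p : Fin 5 → ℝ | ∀ k, 0 < family p k}.Nonempty ∧
      Function.Injective fun p : Fin 5 → ℝ => diagMetric (family p)) ∧
    -- the family consists of all SKT metrics that are also right `T`-invariant
    (∀ g : LinearMap.BilinForm ℝ 𝔤, IsHermitianMetric g → IsRightTorusInvariant g →
      (IsSKT g ↔ ∃ p : Fin 5 → ℝ, (∀ k, 0 < family p k) ∧ g = diagMetric (family p))) ∧
    -- comparison with the normalised Killing metric
    IsHermitianMetric killingMetric ∧ IsSKT killingMetric ∧
    (∀ p : Fin 5 → ℝ, (∀ k, 0 < family p k) →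
      (fundamentalForm (diagMetric (family p)) = fundamentalForm killingMetric ↔
        p = fun _ => 1) ∧
      leftInv (fundamentalForm (diagMetric (family p))) =
        (scale p : ℂ) • leftInv (fundamentalForm killingMetric)
          - ((1 / 2 * (p 0 + p 1 - 2 * p 2 + 2 * p 3 - 2 * p 4) : ℝ) : ℂ) •
              d (leftInv (oneForm (φ 0 + φbar 0)))
          - (Complex.I / 2 * ((p 0 - 2 * p 2 + 3 * p 3 - 2 * p 4 : ℝ) : ℂ)) •
              d (leftInv (oneForm (φbar 0 - φ 0)))
          - ((1 / 2 * (p 0 - 2 * p 2 + 2 * p 3 - p 4) : ℝ) : ℂ) •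
              d (leftInv (oneForm (φ 1 + φbar 1)))
          - (Complex.I / 2 * ((p 0 - p 2 + p 3 - p 4 : ℝ) : ℂ)) •
              d (leftInv (oneForm (φbar 1 - φ 1))) ∧
      0 < scale p ∧
      aeppliClass (leftInv (fundamentalForm (diagMetric (family p)))) =
        (scale p : ℂ) • aeppliClass (leftInv (fundamentalForm killingMetric))) := by
  refine ⟨⟨I_I, nijenhuis_eq_zero, I_eX 0, I_eX 1, I_eX, fun k j => ?_, fun k l => ?_⟩,
    fun b hb => ⟨isHermitianMetric_diagMetric hb, isRightTorusInvariant_diagMetric b,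
      fundamentalForm_diagMetric hb, isSKT_diagMetric_iff hb⟩,
    ⟨isOpen_family_pos, family_pos_nonempty, diagMetric_injective.comp family_injective⟩,
    fun g hg hT => isSKT_iff_mem_family hg hT,
    isHermitianMetric_killingMetric, isSKT_killingMetric,
    -- `hp 0` is the positivity of `scale p`, which is the first coefficient of the family by
    -- definition.
    fun p hp => ⟨fundamentalForm_family_eq_iff hp, fundamentalForm_family hp, hp 0,
      aeppliClass_family hp⟩⟩
  · rw [← wt_natAdd]
    exact lie_tor_frame j (Fin.natAdd 2 k)
  · rw [φ_apply, φ_apply, (coord_frame k l).1, (coord_frame k l).2.1, (coord_frame k l).2.2.1,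
      (coord_frame k l).2.2.2]
    split_ifs <;> simp
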